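/- Let $p$ be an odd prime and let $\mathcal{G} = H \rtimes \Gamma$ be a profinite group which is the (internal) semidirect product of a finite normal subgroup $H$ and a subgroup $\Gamma$ that is isomorphic, as a topological group, to $\mathbb{Z}_p$. Let $\Lambda(\mathcal{G}) = \mathbb{Z}_p[[\mathcal{G}]] = \varprojlim \mathbb{Z}_p[\mathcal{G}/\mathcal{N}]$ be its Iwasawa algebra, the limit being over all open normal subgroups $\mathcal{N}$ of $\mathcal{G}$, and let $\mathcal{Q}(\mathcal{G})$ be the total ring of fractions of $\Lambda(\mathcal{G})$, obtained by adjoining inverses of all central regular elements. Suppose that $H$ is a Frobenius group with Frobenius kernel $N$; that is, $H$ has a proper non-trivial subgroup $C$ such that $C \cap gCg^{-1} = \{1\}$ for all $g \in H \setminus C$, and $N$ is the normal subgroup of $H$ such that $H = N \rtimes C$. Suppose that $p$ does not divide $|N|$. Then $N$ is normal in $\mathcal{G}$ and $\Lambda(\mathcal{G})$ is $N$-hybrid. The latter means that, with $e_N := |N|^{-1} \sum_{\sigma \in N} \sigma \in \mathcal{Q}(\mathcal{G})$ and for any open subgroup $\Gamma_0$ of $\Gamma$ that is central in $\mathcal{G}$: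 (i) $e_N \in \Lambda(\mathcal{G})$, and (ii) $\Lambda(\mathcal{G})(1 - e_N)$ is a maximal $\mathbb{Z}_p[[\Gamma_0]]$-order in $\mathcal{Q}(\mathcal{G})(1 - e_N)$. Here, for a central idempotent $e$ of $\mathcal{Q}(\mathcal{G})$ and $R = \mathbb{Z}_p[[\Gamma_0]]$, an $R$-order in $\mathcal{Q}(\mathcal{G})e$ is a subring with identity $e$ that is a finitely generated $R$-submodule and spans $\mathcal{Q}(\mathcal{G})e$ over the field of fractions of $R$; it is maximal if it is not properly contained in another $R$-order in $\mathcal{Q}(\mathcal{G})e$. -/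

import Mathlib

noncomputable section

namespace HybridIwasawa

section CompletedGroupRing

variable (p : ℕ) [Fact p.Prime] (G : Type*) [Group G] [TopologicalSpace G]

/-- The transition map `ℤ_p[G/U] → ℤ_p[G/V]` for open normal subgroups `U ≤ V` of `G`. -/
def transition {U V : OpenNormalSubgroup G} (h : U.toSubgroup ≤ V.toSubgroup) :
    MonoidAlgebra ℤ_[p] (G ⧸ U.toSubgroup) →ₐ[ℤ_[p]] MonoidAlgebra ℤ_[p] (G ⧸ V.toSubgroup) :=
  MonoidAlgebra.mapDomainAlgHom ℤ_[p] ℤ_[p]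
    (QuotientGroup.map U.toSubgroup V.toSubgroup (MonoidHom.id G) h)

/-- The inverse limit `ℤ_p[[G]] = lim ℤ_p[G/U]` over all open normal subgroups `U` of `G`,
as the algebra of compatible families in the product of all the `ℤ_p[G/U]`. -/
def iwasawaSubalgebra :
    Subalgebra ℤ_[p] ((U : OpenNormalSubgroup G) → MonoidAlgebra ℤ_[p] (G ⧸ U.toSubgroup)) where
  carrier := {x | ∀ (U V : OpenNormalSubgroup G) (h : U.toSubgroup ≤ V.toSubgroup),
    transition p G h (x U) = x V}
  mul_mem' hx hy U V h := by simp [hx U V h, hy U V h]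
  add_mem' hx hy U V h := by simp [hx U V h, hy U V h]
  algebraMap_mem' r U V h := AlgHom.commutes _ r

/-- The Iwasawa algebra `Λ(G) = ℤ_p[[G]]`. -/
abbrev IwasawaAlgebra : Type _ := iwasawaSubalgebra p G

variable {G}

/-- The image in `ℤ_p[[G]]` of an element of `G`. -/
def of (g : G) : IwasawaAlgebra p G :=
  ⟨fun U => MonoidAlgebra.of ℤ_[p] _ (g : G ⧸ U.toSubgroup), fun _ _ _ =>
    MonoidAlgebra.mapDomain_single⟩

variable {A : Type*} [Group A] [TopologicalSpace A]

/-- The preimage of an open normal subgroup under a continuous homomorphism. -/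
def preimage (f : A →ₜ* G) (U : OpenNormalSubgroup G) : OpenNormalSubgroup A where
  toOpenSubgroup := U.toOpenSubgroup.comap f.toMonoidHom f.continuous_toFun
  isNormal' := U.isNormal'.comap f.toMonoidHom

/-- The ring homomorphism `ℤ_p[A/f⁻¹(U)] → ℤ_p[G/U]` induced by `f : A → G`. -/
def levelMap (f : A →ₜ* G) (U : OpenNormalSubgroup G) :
    MonoidAlgebra ℤ_[p] (A ⧸ (preimage f U).toSubgroup) →ₐ[ℤ_[p]]
      MonoidAlgebra ℤ_[p] (G ⧸ U.toSubgroup) :=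
  MonoidAlgebra.mapDomainAlgHom ℤ_[p] ℤ_[p]
    (QuotientGroup.map (preimage f U).toSubgroup U.toSubgroup f.toMonoidHom le_rfl)

/-- The homomorphism `ℤ_p[[A]] → ℤ_p[[G]]` induced by a continuous homomorphism `f : A → G`. -/
def map (f : A →ₜ* G) : IwasawaAlgebra p A →ₐ[ℤ_[p]] IwasawaAlgebra p G where
  toFun x := ⟨fun U => levelMap p f U (x.1 (preimage f U)), fun U V h => by
    have hx := x.2 (preimage f U) (preimage f V) (fun a ha => h ha)
    change transition p G h (levelMap p f U (x.1 (preimage f U))) =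
      levelMap p f V (x.1 (preimage f V))
    rw [← hx]
    generalize x.1 (preimage f U) = y
    induction y using MonoidAlgebra.induction_on with
    | of a =>
      induction a using QuotientGroup.induction_on
      simp only [transition, levelMap, MonoidAlgebra.of_apply, MonoidAlgebra.mapDomainAlgHom_apply,
        MonoidAlgebra.mapDomain_single]
      rfl
    | add a b ha hb => simp only [map_add, ha, hb]
    | smul r a ha => simp only [map_smul, ha]⟩
  map_one' := by ext1; funext U; simp
  map_mul' x y := by ext1; funext U; simp
  map_zero' := by ext1; funext U; simp
  map_add' x y := by ext1; funext U; simp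
  commutes' r := by ext1; funext U; exact AlgHom.commutes _ r

/-- The inclusion of a subgroup of the centre of `G`, as a continuous homomorphism. -/
def centralInclusion (C : Subgroup (Subgroup.center G)) : C →ₜ* G where
  toMonoidHom := (Subgroup.center G).subtype.comp C.subtype
  continuous_toFun := continuous_subtype_val.comp continuous_subtype_val

theorem levelMap_commute (C : Subgroup (Subgroup.center G)) (U : OpenNormalSubgroup G)
    (x : MonoidAlgebra ℤ_[p] (C ⧸ (preimage (centralInclusion C) U).toSubgroup))
    (y : MonoidAlgebra ℤ_[p] (G ⧸ U.toSubgroup)) :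
    Commute (levelMap p (centralInclusion C) U x) y := by
  induction x using MonoidAlgebra.induction_on with
  | add a b ha hb => rw [map_add]; exact ha.add_left hb
  | smul r a ha => rw [map_smul]; exact ha.smul_left r
  | of c =>
    induction y using MonoidAlgebra.induction_on with
    | add a b ha hb => exact ha.add_right hb
    | smul r a ha => exact ha.smul_right r
    | of g =>
      induction c using QuotientGroup.induction_on with | _ c
      induction g using QuotientGroup.induction_on with | _ g
      have h : (c : G) * g = g * c := (Subgroup.mem_center_iff.mp c.1.2 g).symm
      simp only [levelMap, MonoidAlgebra.of_apply, MonoidAlgebra.mapDomainAlgHom_apply,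
        MonoidAlgebra.mapDomain_single, Commute, SemiconjBy, MonoidAlgebra.single_mul_single]
      exact congrArg (fun z : G => MonoidAlgebra.single (z : G ⧸ U.toSubgroup) (1 * 1 : ℤ_[p])) h

theorem level_mul_comm (C : Subgroup (Subgroup.center G)) (U : OpenNormalSubgroup C)
    (x y : MonoidAlgebra ℤ_[p] (C ⧸ U.toSubgroup)) : Commute x y := by
  induction x using MonoidAlgebra.induction_on with
  | add a b ha hb => exact ha.add_left hb
  | smul r a ha => exact ha.smul_left r
  | of c =>
    induction y using MonoidAlgebra.induction_on with
    | add a b ha hb => exact ha.add_right hb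
    | smul r a ha => exact ha.smul_right r
    | of g =>
      induction c using QuotientGroup.induction_on with | _ c
      induction g using QuotientGroup.induction_on with | _ g
      have h : c * g = g * c := Subtype.ext (Subtype.ext (Subgroup.mem_center_iff.mp g.1.2 c))
      simp only [MonoidAlgebra.of_apply, Commute, SemiconjBy, MonoidAlgebra.single_mul_single]
      exact congrArg (fun z : C => MonoidAlgebra.single (z : C ⧸ U.toSubgroup) (1 * 1 : ℤ_[p])) h

instance (C : Subgroup (Subgroup.center G)) : CommRing (IwasawaAlgebra p C) where
  __ := (inferInstance : Ring (IwasawaAlgebra p C))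
  mul_comm x y := by ext1; funext U; exact level_mul_comm p C U _ _

/-- For a subgroup `C` of the centre of `G`, the ring `ℤ_p[[G]]` is an algebra over the commutative
ring `ℤ_p[[C]]`, via the homomorphism induced by the inclusion. -/
instance (C : Subgroup (Subgroup.center G)) :
    Algebra (IwasawaAlgebra p C) (IwasawaAlgebra p G) :=
  RingHom.toAlgebra' (map p (centralInclusion C)).toRingHom fun _ _ =>
    Subtype.ext (funext fun U => levelMap_commute p C U _ _)

end CompletedGroupRing

section TotalRingOfFractions

variable (L : Type*) [Ring L]

/-- The central elements of a ring that are regular (neither left nor right zero divisors). -/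
def centralRegular : Submonoid (Subring.center L) :=
  (nonZeroDivisors L).comap (Subring.center L).subtype

/-- The total ring of fractions of a (possibly noncommutative) ring, obtained by adjoining inverses
of all central regular elements. -/
def TotalFractionRing : Type _ := LocalizedModule (centralRegular L) L

instance : Ring (TotalFractionRing L) :=
  inferInstanceAs (Ring (LocalizedModule (centralRegular L) L))

/-- The canonical homomorphism to the total ring of fractions. -/
def toFractions : L →+* TotalFractionRing L :=
  LocalizedModule.numeratorRingHom (S := centralRegular L)

variable {L} in
/-- The fraction `x / s`, for `x` in the ring and `s` a central regular element. -/
def fraction (x : L) (s : centralRegular L) : TotalFractionRing L :=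
  LocalizedModule.mk x s

variable (R : Type*) [CommRing R] [Algebra R L]

theorem fraction_commute (r : R) (x : LocalizedModule (centralRegular L) L) :
    LocalizedModule.mk (algebraMap R L r) 1 * x = x * LocalizedModule.mk (algebraMap R L r) 1 := by
  induction x using LocalizedModule.induction_on with
  | h m s =>
    rw [LocalizedModule.mk_mul_mk, LocalizedModule.mk_mul_mk, one_mul, mul_one, Algebra.commutes]

instance : Algebra R (TotalFractionRing L) :=
  RingHom.toAlgebra' ((toFractions L).comp (algebraMap R L)) fun r x =>
    fraction_commute L R r x

/-- The canonical homomorphism to the total ring of fractions, over a base ring `R`. -/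
def toFractionsₐ : L →ₐ[R] TotalFractionRing L where
  __ := toFractions L
  commutes' _ := rfl

end TotalRingOfFractions

section Orders

/-- Let `R` be an integral domain with field of fractions `E`, let `A` be an `R`-algebra and `e` a
central idempotent of `A` such that the ring `A e` (with identity `e`) is an `E`-algebra.
`IsOrder R e M` says that `M` is an `R`-order in `A e`: a subring of `A e` with the same identity
`e`, which is a finitely generated `R`-submodule and spans `A e` over `E`, i.e. every element of
`A e` has a multiple by a nonzero element of `R` in `M`. -/
structure IsOrder (R : Type*) {A : Type*} [CommRing R] [Ring A] [Algebra R A] (e : A)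
    (M : Submodule R A) : Prop where
  le : ∀ x ∈ M, x * e = x
  one_mem : e ∈ M
  mul_mem : ∀ x ∈ M, ∀ y ∈ M, x * y ∈ M
  fg : M.FG
  full : ∀ a : A, ∃ r ∈ nonZeroDivisors R, r • (a * e) ∈ M

/-- `M` is a maximal `R`-order in `A e`: an `R`-order in `A e` that is not properly contained
in another one. -/
def IsMaximalOrder (R : Type*) {A : Type*} [CommRing R] [Ring A] [Algebra R A] (e : A)
    (M : Submodule R A) : Prop :=
  Maximal (IsOrder R e) M

end Orders

section Hybrid

variable (p : ℕ) [Fact p.Prime] {G : Type*} [Group G] [TopologicalSpace G]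

theorem natCast_mem_nonZeroDivisors {n : ℕ} (hn : n ≠ 0) :
    (n : IwasawaAlgebra p G) ∈ nonZeroDivisors (IwasawaAlgebra p G) := by
  have key : ∀ x : IwasawaAlgebra p G, (n : IwasawaAlgebra p G) * x = 0 → x = 0 := by
    intro x hx
    ext U g
    have h := congrArg (fun y : IwasawaAlgebra p G => (y.1 U).coeff g) hx
    rw [← nsmul_eq_mul] at h
    have h' : n • (x.1 U).coeff g = 0 := h
    exact (smul_eq_zero.mp h').resolve_left hn
  refine mem_nonZeroDivisors_iff.mpr ⟨key, fun x hx => key x ?_⟩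
  rw [(Nat.cast_commute n x).eq, hx]

/-- The total ring of fractions `𝒬(G)` of the Iwasawa algebra of `G`. -/
abbrev Q (G : Type*) [Group G] [TopologicalSpace G] : Type _ :=
  TotalFractionRing (IwasawaAlgebra p G)

/-- The trace idempotent `e_N = |N|⁻¹ ∑_{σ ∈ N} σ` in `𝒬(G)` of a finite subgroup `N`. -/
def traceIdempotent (N : Subgroup G) [Finite N] : Q p G :=
  fraction (∑ᶠ σ : N, of p (σ : G))
    ⟨(Nat.card N : Subring.center (IwasawaAlgebra p G)), by
      simpa [centralRegular] using
        natCast_mem_nonZeroDivisors p (G := G) (Nat.card_pos (α := N)).ne'⟩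

instance {H : Subgroup G} [Finite H] (N : Subgroup H) : Finite (N.map H.subtype) :=
  Finite.of_surjective _ (H.subtype.subgroupMap_surjective N)

/-- The Iwasawa algebra `Λ(G)` is `N`-hybrid, for a finite normal subgroup `N` of `G`:
(i) `e_N ∈ Λ(G)`, and
(ii) `Λ(G)(1 - e_N)` is a maximal `ℤ_p[[Γ₀]]`-order in `𝒬(G)(1 - e_N)`.
Here `Γ₀` is the chosen central subgroup of `G`. -/
structure IsHybrid (N : Subgroup G) [Finite N] (Γ₀ : Subgroup (Subgroup.center G)) : Prop where
  normal : N.Normal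
  mem : traceIdempotent p N ∈ (toFractions (IwasawaAlgebra p G)).range
  maximal : IsMaximalOrder (IwasawaAlgebra p Γ₀) (1 - traceIdempotent p N)
    ((LinearMap.mulRight (IwasawaAlgebra p Γ₀) (1 - traceIdempotent p N)).comp
      (toFractionsₐ (IwasawaAlgebra p G) (IwasawaAlgebra p Γ₀)).toLinearMap).range

end Hybrid

section Frobenius

variable {H : Type*} [Group H]

/-- `C` is a Frobenius complement in `H`: a proper nontrivial subgroup with
`C ∩ g C g⁻¹ = 1` for all `g ∉ C`. -/
structure IsFrobeniusComplement (C : Subgroup H) : Prop where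
  ne_bot : C ≠ ⊥
  ne_top : C ≠ ⊤
  inf_conj : ∀ g : H, g ∉ C → C ⊓ C.map (MulAut.conj g).toMonoidHom = ⊥

/-- The finite group `H` is a Frobenius group with Frobenius kernel `N`: there is a Frobenius
complement `C` in `H`, and `N` is the normal subgroup with `H = N ⋊ C`. -/
def IsFrobeniusWithKernel (H : Type*) [Group H] [Finite H] (N : Subgroup H) : Prop :=
  N.Normal ∧ ∃ C : Subgroup H, IsFrobeniusComplement C ∧ N.IsComplement' C

end Frobenius

/-- `𝒢 = H ⋊ Γ` (as an internal semidirect product of subgroups) with `H` a finite normal subgroup and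
`Γ ≃ ℤ_p` as topological groups. -/
structure IsSemidirect (p : ℕ) [Fact p.Prime] {G : Type*} [Group G] [TopologicalSpace G]
    (H Γ : Subgroup G) [Finite H] : Prop where
  normal : H.Normal
  isComplement : H.IsComplement' Γ
  equiv : Nonempty (Γ ≃ₜ* Multiplicative ℤ_[p])

end HybridIwasawa

end

noncomputable section

namespace HybridIwasawa

/-! ### Frobenius groups: cosets of the kernel are conjugacy classes. -/

section FrobeniusGroups

variable {H : Type*} [Group H] {N C : Subgroup H}

/-! Normality. For `h ∈ H` outside `N`, conjugation by `N` is transitive on the coset `N h`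
(`IsFrobeniusWithKernel.exists_conj_eq_mul`). So the image of `N` under an automorphism of `H`, if
not inside `N`, contains `N`, and counting shows that `N` is characteristic in `H`. As `p` does not
divide `|N|`, the idempotent `e_N` lies in `Λ = Λ(𝒢)`.

Reduction modulo `p`. Put `R = ℤ_p[[Γ₀]] ≅ ℤ_p[[X]]`, which is integrally closed; `Λ` is free over
`R` on representatives of `𝒢/Γ₀`. The trace of left multiplication by `a` is `[𝒢 : Γ₀]` times the
coefficient of `a` at the trivial coset. Since elements of orders are integral, every order `M ⊇ Λ(1
- e_N)` satisfies `p ^ n M ⊆ Λ` for some `n` (`exists_smul_eq_toFractions_of_isOrder`). If the least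
`n` is positive, some `x ∈ M` has `p ^ (n-1) x ∉ Λ`, and `a = p ^ n x` satisfies `a Λ a ⊆ p Λ` but
`a ∉ p Λ`. So it suffices that `Λ(1 - e_N)/p` is semiprime (`isMaximalOrder_range`).

Semiprimeness. Let `k` be an algebraic closure of `𝔽_p` and `E = Frac k[[X]]`. Then `Λ/p` embeds in
`B = E ⊗ Λ`, a twisted group algebra of `𝒢/Γ₀`. In the semisimple algebra `k[N]`, `1` is a sum of
rank one idempotents `f`, each belonging to an irreducible representation of `N`. If that
representation is nontrivial, no `h ∈ H \ N` fixes it, because `N h` is a single class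
(`IsRankOneIdempotent.mul_conjAlgEquiv_eq_zero`). Its stabilizer modulo `N` therefore embeds in `𝒢/H
≅ ℤ_p`, and `f B f` is a quotient of `E[T]/(T ^ (p ^ m) - c(1 + X))` with `c ∈ kˣ`. Since `c(1 + X)`
has nonzero derivative, it is not a `p`-th power in `E`; for odd `p` the polynomial is then
irreducible and `f B f` is reduced (`IsRankOneIdempotent.corner_reduced`). Hence `x B x = 0` forces
`f x f' = 0` for all `f`, `f'`, so `x = 0` (`eq_zero_of_forall_mul_mul_eq_zero`). -/

theorem IsFrobeniusComplement.eq_one_of_commute (hC : IsFrobeniusComplement C)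
    (hNC : N.IsComplement' C) {c x : H} (hc : c ∈ C) (hc1 : c ≠ 1) (hx : x ∈ N)
    (h : x * c = c * x) : x = 1 := by
  by_cases hxC : x ∈ C
  · exact Subgroup.disjoint_def.mp hNC.disjoint hx hxC
  · refine absurd ?_ hc1
    have : c ∈ C ⊓ C.map (MulAut.conj x).toMonoidHom :=
      ⟨hc, c, hc, by simp [h]⟩
    rwa [hC.inf_conj x hxC, Subgroup.mem_bot] at this

variable [Finite H]

/-- The commutator map `m ↦ m c m⁻¹ c⁻¹` on `N` is injective because `c` centralizes no nontrivial
element of `N`; as `N` is finite, it is surjective. -/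
theorem IsFrobeniusComplement.exists_conj_eq_mul (hC : IsFrobeniusComplement C) (hN : N.Normal)
    (hNC : N.IsComplement' C) {c n : H} (hc : c ∈ C) (hc1 : c ≠ 1) (hn : n ∈ N) :
    ∃ m ∈ N, m * c * m⁻¹ = n * c := by
  let φ : N → N := fun m => ⟨m * (c * (m : H)⁻¹ * c⁻¹),
    N.mul_mem m.2 (hN.conj_mem _ (N.inv_mem m.2) c)⟩
  have hφ : Function.Injective φ := by
    intro a b hab
    have h1 : (a : H) * (c * (a : H)⁻¹ * c⁻¹) = b * (c * (b : H)⁻¹ * c⁻¹) :=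
      congrArg Subtype.val hab
    have h2 : ((b : H)⁻¹ * a) = 1 := by
      refine hC.eq_one_of_commute hNC hc hc1 (N.mul_mem (N.inv_mem b.2) a.2) ?_
      have h3 : (a : H) * c * (a : H)⁻¹ = b * c * (b : H)⁻¹ := by
        simpa [mul_assoc] using congrArg (· * c) h1
      calc (b : H)⁻¹ * a * c = (b : H)⁻¹ * (a * c * (a : H)⁻¹) * a := by group
        _ = c * ((b : H)⁻¹ * a) := by rw [h3]; group
    exact Subtype.ext (inv_mul_eq_one.mp h2).symm
  obtain ⟨m, hm⟩ := Finite.surjective_of_injective hφ ⟨n, hn⟩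
  refine ⟨m, m.2, ?_⟩
  have : (m : H) * (c * (m : H)⁻¹ * c⁻¹) = n := congrArg Subtype.val hm
  rw [← this]; group

/-- Outside the Frobenius kernel, a coset of the kernel is a single conjugacy class under it. -/
theorem IsFrobeniusWithKernel.exists_conj_eq_mul (hN : IsFrobeniusWithKernel H N) {h n : H}
    (hh : h ∉ N) (hn : n ∈ N) : ∃ m ∈ N, m * h * m⁻¹ = n * h := by
  obtain ⟨hnorm, C, hC, hNC⟩ := hN
  obtain ⟨⟨⟨a, ha⟩, ⟨c, hc⟩⟩, hac : a * c = h⟩ := hNC.2 h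
  have hc1 : c ≠ 1 := by rintro rfl; exact hh (by rw [← hac, mul_one]; exact ha)
  obtain ⟨m, hm, h1⟩ := hC.exists_conj_eq_mul hnorm hNC hc hc1 (N.mul_mem hn ha)
  obtain ⟨m', hm', h2⟩ := hC.exists_conj_eq_mul hnorm hNC hc hc1 ha
  refine ⟨m * m'⁻¹, N.mul_mem hm (N.inv_mem hm'), ?_⟩
  rw [← hac, ← h2]
  have h3 : n * m' * c * m'⁻¹ = n * a * c := by rw [mul_assoc n a c, ← h2]; group
  rw [show n * (m' * c * m'⁻¹) = n * a * c by rw [← h3]; group, ← h1]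
  group

/-- If `x ∈ φ(N)` lies outside `N`, the coset `N x` consists of conjugates of `x`, so it lies in the
normal subgroup `φ(N)`. Then `N ≤ φ(N)`, and the equal orders give equality. -/
theorem IsFrobeniusWithKernel.map_eq (hN : IsFrobeniusWithKernel H N) (φ : H ≃* H) :
    N.map φ.toMonoidHom = N := by
  have hnorm := hN.1
  have hcard : Nat.card (N.map φ.toMonoidHom) = Nat.card N :=
    Subgroup.card_map_of_injective φ.injective
  have hφ : (N.map φ.toMonoidHom).Normal := hnorm.map _ φ.surjective
  by_contra hne
  have hle : ¬ N.map φ.toMonoidHom ≤ N := fun hle =>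
    hne (Subgroup.eq_of_le_of_card_ge hle hcard.ge)
  obtain ⟨x, hx, hxN⟩ := SetLike.not_le_iff_exists.mp hle
  refine hne (Subgroup.eq_of_le_of_card_ge (fun n hn => ?_) hcard.le).symm
  obtain ⟨m, -, hm⟩ := hN.exists_conj_eq_mul hxN hn
  have h1 : n * x ∈ N.map φ.toMonoidHom := hm ▸ hφ.conj_mem x hx m
  exact (Subgroup.mul_mem_cancel_right _ hx).mp h1

/-- The Frobenius kernel of a normal subgroup is normal in the whole group. -/
theorem IsFrobeniusWithKernel.normal_map {G : Type*} [Group G] {H : Subgroup G} [Finite H]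
    {N : Subgroup H} (hN : IsFrobeniusWithKernel H N) (hH : H.Normal) :
    (N.map H.subtype).Normal := by
  refine ⟨?_⟩
  rintro _ ⟨n, hn, rfl⟩ g
  have h1 : MulAut.conjNormal g n ∈ N.map (MulAut.conjNormal (H := H) g).toMonoidHom :=
    ⟨n, hn, rfl⟩
  rw [hN.map_eq] at h1
  exact ⟨_, h1, by simp⟩

end FrobeniusGroups

/-! ### Rank one idempotents in semisimple algebras. -/

section RankOneIdempotents

/-- An idempotent `f ≠ 0` of a `k`-algebra `A` with `f A f = k f`. -/
structure IsRankOneIdempotent (k : Type*) {A : Type*} [Field k] [Ring A] [Algebra k A] (f : A) :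
    Prop where
  ne_zero : f ≠ 0
  mul_self : f * f = f
  exists_smul : ∀ a : A, ∃ c : k, f * a * f = c • f

/-- Von Neumann regularity: the left ideal `A u` has a complement `J`; writing `1 = a u + j`, the
element `u j = u - u a u` lies in `A u ∩ J = 0`. -/
theorem exists_mul_mul_self_of_isSemisimpleRing {A : Type*} [Ring A] [IsSemisimpleRing A] (u : A) :
    ∃ a, u * a * u = u := by
  obtain ⟨J, hJ⟩ := exists_isCompl (Ideal.span {u})
  obtain ⟨i, hi, j, hj, hij⟩ :=
    Submodule.mem_sup.mp (hJ.sup_eq_top ▸ Submodule.mem_top (x := (1 : A)))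
  obtain ⟨a, rfl⟩ := Ideal.mem_span_singleton'.mp hi
  have h1 : u * j ∈ Ideal.span {u} := by
    have : u * j = u - u * (a * u) := by
      rw [eq_sub_iff_add_eq, ← mul_add, add_comm, hij, mul_one]
    rw [this]
    exact sub_mem (Ideal.mem_span_singleton_self u) (Ideal.mul_mem_left _ _ hi)
  have h2 : u * j = 0 := by
    have := hJ.inf_eq_bot.le (show u * j ∈ _ from ⟨h1, J.smul_mem u hj⟩)
    simpa using this
  refine ⟨a, ?_⟩
  have h3 := congrArg (u * ·) hij
  simp only [mul_add, h2, add_zero, mul_one] at h3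
  rw [mul_assoc, h3]

variable {k A : Type*} [Field k] [Ring A] [Algebra k A]

theorem IsRankOneIdempotent.of_algEquiv {B : Type*} [Ring B] [Algebra k B] (e : A ≃ₐ[k] B)
    {f : A} (hf : IsRankOneIdempotent k f) : IsRankOneIdempotent k (e f) where
  ne_zero := by simpa using hf.ne_zero
  mul_self := by rw [← map_mul, hf.mul_self]
  exists_smul b := by
    obtain ⟨c, hc⟩ := hf.exists_smul (e.symm b)
    refine ⟨c, ?_⟩
    rw [← map_smul, ← hc]
    simp

theorem isRankOneIdempotent_single {n : ℕ} {d : Fin n → ℕ} (i : Fin n) (j : Fin (d i)) :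
    IsRankOneIdempotent k
      (Pi.single i (Matrix.single j j 1) : Π i, Matrix (Fin (d i)) (Fin (d i)) k) where
  ne_zero h := by
    have := congrFun (congrFun (congrFun h i) j) j
    simp at this
  mul_self := by rw [← Pi.single_mul]; simp
  exists_smul a := by
    refine ⟨a i j j, ?_⟩
    funext l
    rcases eq_or_ne l i with rfl | h
    · simp [Matrix.single_mul_mul_single]
    · simp [Pi.single_eq_of_ne h]

/-- In a split semisimple algebra, `1` is a sum of idempotents of rank one. -/
theorem exists_sum_isRankOneIdempotent (k A : Type*) [Field k] [IsAlgClosed k] [Ring A]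
    [Algebra k A] [IsSemisimpleRing A] [FiniteDimensional k A] :
    ∃ (ι : Type) (_ : Fintype ι) (f : ι → A), ∑ i, f i = 1 ∧
      ∀ i, IsRankOneIdempotent k (f i) := by
  obtain ⟨n, d, -, ⟨e⟩⟩ := IsSemisimpleRing.exists_algEquiv_pi_matrix_of_isAlgClosed k A
  refine ⟨Σ i, Fin (d i), inferInstance,
    fun x => e.symm (Pi.single x.1 (Matrix.single x.2 x.2 1)), ?_, fun x =>
      (isRankOneIdempotent_single x.1 x.2).of_algEquiv e.symm⟩
  rw [← map_sum, Fintype.sum_sigma, ← map_one e.symm]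
  congr 1
  have h (i : Fin n) : ∑ j, (Pi.single i (Matrix.single j j 1) :
      Π i, Matrix (Fin (d i)) (Fin (d i)) k) = Pi.single i 1 := by
    rw [← Matrix.sum_single_one]
    exact (map_sum (AddMonoidHom.single (fun i => Matrix (Fin (d i)) (Fin (d i)) k) i) _ _).symm
  simp only [h]
  exact Finset.univ_sum_single 1

/-- A nonzero `u ∈ f A f'` is an isomorphism between the simple modules attached to `f` and `f'`.
Concretely, if `u a u = u` and `v = f' a f`, then `u v` and `v u` are nonzero idempotents in the
one-dimensional corners at `f` and `f'`, hence equal to `f` and `f'`. -/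
theorem IsRankOneIdempotent.exists_inverse [IsSemisimpleRing A] {f f' u : A}
    (hf : IsRankOneIdempotent k f) (hf' : IsRankOneIdempotent k f') (hu : f * u * f' = u)
    (hu0 : u ≠ 0) : ∃ v, f' * v * f = v ∧ u * v = f ∧ v * u = f' := by
  obtain ⟨a, ha⟩ := exists_mul_mul_self_of_isSemisimpleRing u
  have hfu : f * u = u := by rw [← hu, ← mul_assoc, ← mul_assoc, hf.mul_self]
  have huf : u * f' = u := by rw [← hu, mul_assoc, hf'.mul_self]
  have key : ∀ {g : A} {x : A}, IsRankOneIdempotent k g → g * x * g = x → x * x = x → x ≠ 0 →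
      x = g := by
    intro g x hg hx hxx hx0
    obtain ⟨c, hc⟩ := hg.exists_smul x
    rw [hx] at hc
    have h1 : c • x = (1 : k) • x := by
      rw [one_smul]
      nth_rw 2 [← hxx]
      nth_rw 2 [hc]
      rw [smul_mul_assoc, ← hx, ← mul_assoc, ← mul_assoc, hg.mul_self]
    rw [hc, smul_left_injective k hx0 h1, one_smul]
  have huvu : u * (f' * a * f) * u = u := by
    calc u * (f' * a * f) * u = (u * f') * a * (f * u) := by noncomm_ring
      _ = u := by rw [hfu, huf, ha]
  refine ⟨f' * a * f, ?_, key hf ?_ ?_ ?_, key hf' ?_ ?_ ?_⟩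
  · calc f' * (f' * a * f) * f = (f' * f') * a * (f * f) := by noncomm_ring
      _ = _ := by rw [hf.mul_self, hf'.mul_self]
  · calc f * (u * (f' * a * f)) * f = (f * u) * (f' * a * (f * f)) := by noncomm_ring
      _ = _ := by rw [hf.mul_self, hfu]
  · rw [← mul_assoc, huvu]
  · intro h; rw [h, zero_mul] at huvu; exact hu0 huvu.symm
  · calc f' * (f' * a * f * u) * f' = (f' * f') * a * f * (u * f') := by noncomm_ring
      _ = _ := by rw [hf'.mul_self, huf]
  · rw [mul_assoc, ← mul_assoc u, huvu]
  · intro h; rw [mul_assoc, h, mul_zero] at huvu; exact hu0 huvu.symm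

end RankOneIdempotents

/-! ### Conjugation on `k[N]` and the representations it moves. -/

section ConjugationAction

variable {k G : Type*} [Field k] [Group G] (N : Subgroup G)

variable [N.Normal]

/-- The automorphism of `k[N]` induced by conjugation with an element of `G`, for `N` normal. -/
def conjAlgEquiv (g : G) : MonoidAlgebra k N ≃ₐ[k] MonoidAlgebra k N :=
  MonoidAlgebra.domCongr k k (MulAut.conjNormal g)

theorem conjAlgEquiv_single (g : G) (n : N) (c : k) :
    conjAlgEquiv N g (MonoidAlgebra.single n c) =
      MonoidAlgebra.single (MulAut.conjNormal g n) c := by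
  simp [conjAlgEquiv]

theorem coeff_one_mul_comm {N : Type*} [Group N] (a b : MonoidAlgebra k N) :
    (a * b).coeff 1 = (b * a).coeff 1 := by
  induction a using MonoidAlgebra.induction_on with
  | add a b ha hb => simp [add_mul, mul_add, ha, hb]
  | smul r a ha => simp [ha]
  | of n =>
    simp

variable [Fintype N]

theorem sum_coeff_smul_single {N : Type*} [Group N] [Fintype N] (a : MonoidAlgebra k N) :
    ∑ n, a.coeff n • MonoidAlgebra.single n (1 : k) = a := by
  classical
  ext m
  simp

/-- The coefficient at `1` is a trace form. Applied to `f m⁻¹ f = c f` it shows that every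
coefficient of `f` is a multiple of the one at `1`. -/
theorem IsRankOneIdempotent.coeff_one_ne_zero {N : Type*} [Group N] {f : MonoidAlgebra k N}
    (hf : IsRankOneIdempotent k f) : f.coeff 1 ≠ 0 := by
  intro h
  refine hf.ne_zero ?_
  ext m
  obtain ⟨c, hc⟩ := hf.exists_smul (MonoidAlgebra.single m⁻¹ 1)
  have h1 := congrArg (fun x => x.coeff 1) hc
  simp only [mul_assoc] at h1
  rw [coeff_one_mul_comm, mul_assoc, hf.mul_self] at h1
  simpa [h] using h1

theorem IsRankOneIdempotent.mul_single_mul {N : Type*} [Group N] {f : MonoidAlgebra k N}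
    (hf : IsRankOneIdempotent k f) (m : N) :
    f * MonoidAlgebra.single m⁻¹ 1 * f = (f.coeff m / f.coeff 1) • f := by
  obtain ⟨c, hc⟩ := hf.exists_smul (MonoidAlgebra.single m⁻¹ 1)
  have h1 := congrArg (fun x => x.coeff 1) hc
  simp only [mul_assoc] at h1
  rw [coeff_one_mul_comm, mul_assoc, hf.mul_self] at h1
  have h2 : f.coeff m = c * f.coeff 1 := by simpa using h1
  rw [hc, h2, mul_div_cancel_right₀ _ hf.coeff_one_ne_zero]

/-- If the coset `N h` is a single conjugacy class under `N`, then `h` moves every nontrivial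
irreducible representation of `N`: here such a representation is given by a rank one idempotent
`f` of `k[N]`. -/
theorem IsRankOneIdempotent.mul_conjAlgEquiv_eq_zero [NeZero (Nat.card N : k)]
    {f : MonoidAlgebra k N} (hf : IsRankOneIdempotent k f)
    (hf0 : (∑ n : N, MonoidAlgebra.single n (1 : k)) * f = 0) {h : G}
    (hh : ∀ n ∈ N, ∃ m ∈ N, m * h * m⁻¹ = n * h) (a : MonoidAlgebra k N) :
    f * a * conjAlgEquiv N h f = 0 := by
  by_contra hu0
  set σ := conjAlgEquiv (k := k) N h
  obtain ⟨v, hv, huv, -⟩ := hf.exists_inverse (hf.of_algEquiv σ)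
    (by rw [mul_assoc, mul_assoc, ← map_mul, hf.mul_self, ← mul_assoc, ← mul_assoc, hf.mul_self])
    hu0
  set u := f * a * σ f
  set s : MonoidAlgebra k N := ∑ n : N, MonoidAlgebra.single n (1 : k)
  have hs (n : N) : s * MonoidAlgebra.single n 1 = s := by
    simp only [s, Finset.sum_mul, MonoidAlgebra.single_mul_single, mul_one]
    exact Fintype.sum_equiv (Equiv.mulRight n) _ _ fun _ => rfl
  -- Averaging `u` gives an intertwiner `t` between the actions of `N` by `m` and by `σ m`. It
  -- vanishes by the class hypothesis, yet `t v` is a nonzero multiple of `f`.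
  set t := ∑ m : N, MonoidAlgebra.single m 1 * u * σ (MonoidAlgebra.single m⁻¹ 1)
  have hst : s * t = 0 := by
    simp only [t, Finset.mul_sum, ← mul_assoc, hs]
    simp only [u, ← mul_assoc, hf0, zero_mul, Finset.sum_const_zero]
  have htm (m : N) : MonoidAlgebra.single m 1 * t * σ (MonoidAlgebra.single m⁻¹ 1) = t := by
    simp only [t, Finset.mul_sum, Finset.sum_mul]
    refine Fintype.sum_equiv (Equiv.mulLeft m) _ _ fun x => ?_
    simp only [Equiv.coe_mulLeft, mul_inv_rev]
    rw [show MonoidAlgebra.single (m * x) (1 : k) =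
        MonoidAlgebra.single m 1 * MonoidAlgebra.single x 1 by
          rw [MonoidAlgebra.single_mul_single, one_mul],
      show MonoidAlgebra.single (x⁻¹ * m⁻¹) (1 : k) =
        MonoidAlgebra.single x⁻¹ 1 * MonoidAlgebra.single m⁻¹ 1 by
          rw [MonoidAlgebra.single_mul_single, one_mul], map_mul]
    simp only [mul_assoc]
  -- The invariance of `t` makes its coefficients constant on orbits of `n ↦ m n (h m⁻¹ h⁻¹)`. After
  -- right translation by `h` these are the `N`-classes in `N h`, so there is only one.
  have htc (n : N) : t.coeff n = t.coeff 1 := by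
    obtain ⟨m, hm, hmn⟩ := hh n n.2
    have h1 : (⟨m, hm⟩ : N) * MulAut.conjNormal h (⟨m, hm⟩ : N)⁻¹ = n := by
      ext
      simp only [Subgroup.coe_mul, MulAut.conjNormal_apply, InvMemClass.coe_inv]
      rw [← mul_assoc, ← mul_assoc, hmn, mul_inv_cancel_right]
    have h2 := congrArg (fun x => x.coeff n) (htm ⟨m, hm⟩)
    simp only [σ, conjAlgEquiv_single] at h2
    rw [← h2]
    rw [MonoidAlgebra.coeff_mul_single_apply, MonoidAlgebra.coeff_single_mul_apply, ← h1]
    simp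
  have ht : t = t.coeff 1 • s := by
    ext n
    classical
    simp [s, htc n, Finsupp.single_apply]
  have hss : s * s = (Nat.card N : k) • s := by
    nth_rw 2 [show s = ∑ n : N, MonoidAlgebra.single n (1 : k) from rfl]
    rw [Finset.mul_sum, Finset.sum_congr rfl fun n _ => hs n]
    simp [Nat.cast_smul_eq_nsmul]
  -- Here `t` is a multiple of the norm element `s`, and `s t = 0`, while `s * s = |N| s` with `|N|`
  -- invertible in `k`.
  have ht0 : t = 0 := by
    rw [ht, mul_smul_comm, hss, smul_smul, mul_comm, mul_smul, ← ht,
      smul_eq_zero] at hst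
    exact hst.resolve_left (NeZero.ne _)
  have hσ (m : N) : u * σ (MonoidAlgebra.single m⁻¹ 1) * v = (f.coeff m / f.coeff 1) • f := by
    have h1 : u * σ f = u := by simp only [u, mul_assoc, ← map_mul, hf.mul_self]
    have h2 : σ f * v = v := by
      rw [← hv, ← mul_assoc, ← mul_assoc, ← map_mul, hf.mul_self]
    calc u * σ (MonoidAlgebra.single m⁻¹ 1) * v
        = (u * σ f) * σ (MonoidAlgebra.single m⁻¹ 1) * (σ f * v) := by rw [h1, h2]
      _ = u * σ (f * MonoidAlgebra.single m⁻¹ 1 * f) * v := by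
        simp only [map_mul, mul_assoc]
      _ = _ := by rw [hf.mul_single_mul, map_smul, mul_smul_comm, smul_mul_assoc, h1, huv]
  have htv : t * v = (f.coeff 1)⁻¹ • f := by
    simp only [t, Finset.sum_mul, mul_assoc]
    simp only [← mul_assoc u, hσ]
    calc _ = ∑ m, (f.coeff 1)⁻¹ • ((f.coeff m • MonoidAlgebra.single m (1 : k)) * f) := by
          refine Finset.sum_congr rfl fun m _ => ?_
          rw [mul_smul_comm, smul_mul_assoc, smul_smul, div_eq_inv_mul]
      _ = _ := by rw [← Finset.smul_sum, ← Finset.sum_mul, sum_coeff_smul_single, hf.mul_self]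
  rw [ht0, zero_mul] at htv
  exact (smul_ne_zero (inv_ne_zero hf.coeff_one_ne_zero) hf.ne_zero) htv.symm

end ConjugationAction

/-! ### Stabilizers of irreducible representations. -/

section ConjAlgEquiv

theorem IsRankOneIdempotent.exists_inverse_mul {k A : Type*} [Field k] [Ring A] [Algebra k A]
    [IsSemisimpleRing A] {f f' a : A} (hf : IsRankOneIdempotent k f)
    (hf' : IsRankOneIdempotent k f') (h : f * a * f' ≠ 0) :
    ∃ v, f' * v * f = v ∧ f * a * f' * v = f ∧ v * (f * a * f') = f' :=
  hf.exists_inverse hf'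
    (by rw [← mul_assoc, ← mul_assoc, hf.mul_self, mul_assoc, hf'.mul_self]) h

variable {k G : Type*} [Field k] [Group G] (N : Subgroup G) [N.Normal]

theorem conjAlgEquiv_mul (g h : G) (a : MonoidAlgebra k N) :
    conjAlgEquiv N (g * h) a = conjAlgEquiv N g (conjAlgEquiv N h a) := by
  induction a using MonoidAlgebra.induction_on with
  | of n => simp [conjAlgEquiv_single]
  | add a b ha hb => simp only [map_add, ha, hb]
  | smul r a ha => simp only [map_smul, ha]

theorem conjAlgEquiv_of_mem_center {g : G} (hg : g ∈ Subgroup.center G) (a : MonoidAlgebra k N) :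
    conjAlgEquiv N g a = a := by
  induction a using MonoidAlgebra.induction_on with
  | of n =>
    have : MulAut.conjNormal g n = n := by
      ext
      rw [MulAut.conjNormal_apply, ← Subgroup.mem_center_iff.mp hg, mul_inv_cancel_right]
    simp [conjAlgEquiv_single, this]
  | add a b ha hb => simp only [map_add, ha, hb]
  | smul r a ha => simp only [map_smul, ha]

variable [Finite N] [NeZero (Nat.card N : k)]

/-- The stabilizer in `G` of the irreducible representation of `N` generated by a rank one
idempotent. -/
def IsRankOneIdempotent.stabilizer {f : MonoidAlgebra k N} (hf : IsRankOneIdempotent k f) :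
    Subgroup G where
  carrier := {g | ∃ a, f * a * conjAlgEquiv N g f ≠ 0}
  one_mem' := ⟨1, by
    rw [conjAlgEquiv_of_mem_center N (Subgroup.one_mem _), mul_one, hf.mul_self]
    exact hf.ne_zero⟩
  mul_mem' := by
    rintro g h ⟨a, ha⟩ ⟨b, hb⟩
    have hσ := hf.of_algEquiv (conjAlgEquiv N g)
    obtain ⟨v, -, -, hvu⟩ := hf.exists_inverse_mul hσ ha
    -- Composite of the nonzero map from `f` to its `g`-conjugate with the `g`-conjugate of the one
    -- from `f` to its `h`-conjugate; the first factor can be cancelled with its inverse `v`.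
    refine ⟨a * conjAlgEquiv N g (f * b), fun h0 => ?_⟩
    have h1 : conjAlgEquiv N g (f * b * conjAlgEquiv N h f) = 0 := by
      calc _ = conjAlgEquiv N g f * conjAlgEquiv N g (f * b * conjAlgEquiv N h f) := by
            rw [← map_mul, ← mul_assoc, ← mul_assoc, hf.mul_self]
        _ = v * (f * (a * conjAlgEquiv N g (f * f * b)) * conjAlgEquiv N (g * h) f) := by
            rw [← hvu, conjAlgEquiv_mul]
            simp only [map_mul, mul_assoc]
        _ = 0 := by rw [hf.mul_self, h0, mul_zero]
    exact hb ((map_eq_zero_iff _ (conjAlgEquiv N g).injective).mp h1)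
  inv_mem' := by
    rintro g ⟨a, ha⟩
    have hσ := hf.of_algEquiv (conjAlgEquiv N g)
    obtain ⟨v, hv, huv, -⟩ := hf.exists_inverse_mul hσ ha
    refine ⟨conjAlgEquiv N g⁻¹ v, fun h0 => ?_⟩
    have h1 : conjAlgEquiv N g (f * conjAlgEquiv N g⁻¹ v * conjAlgEquiv N g⁻¹ f) = v := by
      rw [map_mul, map_mul, ← conjAlgEquiv_mul, ← conjAlgEquiv_mul, mul_inv_cancel,
        conjAlgEquiv_of_mem_center N (Subgroup.one_mem _),
        conjAlgEquiv_of_mem_center N (Subgroup.one_mem _), hv]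
    rw [h0, map_zero] at h1
    rw [← h1, mul_zero] at huv
    exact hf.ne_zero huv.symm

theorem IsRankOneIdempotent.mem_stabilizer {f : MonoidAlgebra k N}
    (hf : IsRankOneIdempotent k f) {g : G} :
    g ∈ hf.stabilizer N ↔ ∃ a, f * a * conjAlgEquiv N g f ≠ 0 := Iff.rfl

end ConjAlgEquiv

/-! ### Corner rings of the twisted group algebra, and semiprimeness. -/

section Corner

open Polynomial

variable {k E G B : Type*} [Field k] [Field E] [Algebra k E] [Group G] [Ring B]
  [Algebra k B] [Algebra E B] [IsScalarTower k E B] (φ : G →* B)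
  (N : Subgroup G)

/-- The homomorphism from the group algebra of a subgroup `N` of `G` induced by a
homomorphism from `G` to an algebra. -/
def restrictLift : MonoidAlgebra k N →ₐ[k] B :=
  MonoidAlgebra.lift k B N (φ.comp N.subtype)

theorem restrictLift_single (n : N) : restrictLift φ N (MonoidAlgebra.single n (1 : k)) = φ n := by
  simp [restrictLift]

theorem sum_single_mul_comm {N : Type*} [Group N] [Fintype N] (a : MonoidAlgebra k N) :
    (∑ n : N, MonoidAlgebra.single n (1 : k)) * a =
      a * ∑ n : N, MonoidAlgebra.single n (1 : k) := by
  induction a using MonoidAlgebra.induction_on with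
  | of n =>
    simp only [MonoidAlgebra.of_apply, Finset.sum_mul, Finset.mul_sum,
      MonoidAlgebra.single_mul_single, mul_one]
    trans ∑ m : N, MonoidAlgebra.single m (1 : k)
    · exact Fintype.sum_equiv (Equiv.mulRight n) _ _ fun _ => rfl
    · exact (Fintype.sum_equiv (Equiv.mulLeft n) _ _ fun _ => rfl).symm
  | add a b ha hb => rw [mul_add, add_mul, ha, hb]
  | smul r a ha => rw [mul_smul_comm, smul_mul_assoc, ha]

/-- A rank one idempotent that does not kill the norm element is killed by every element
killed by the norm element. -/
theorem IsRankOneIdempotent.restrictLift_mul_eq_zero [Fintype N] {f : MonoidAlgebra k N}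
    (hf : IsRankOneIdempotent k f) (hf0 : (∑ n : N, MonoidAlgebra.single n (1 : k)) * f ≠ 0)
    {x : B} (hNx : (∑ n : N, φ n) * x = 0) : restrictLift φ N f * x = 0 := by
  obtain ⟨c, hc⟩ := hf.exists_smul (∑ n : N, MonoidAlgebra.single n (1 : k))
  have hc' : f * (∑ n : N, MonoidAlgebra.single n (1 : k)) = c • f := by
    rw [← hc, mul_assoc, sum_single_mul_comm, ← mul_assoc, hf.mul_self]
  have hc0 : c ≠ 0 := by
    rintro rfl
    rw [zero_smul, ← sum_single_mul_comm] at hc'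
    exact hf0 hc'
  have hjs : restrictLift φ N (∑ n : N, MonoidAlgebra.single n (1 : k)) = ∑ n : N, φ n := by
    rw [map_sum]; exact Finset.sum_congr rfl fun n _ => restrictLift_single φ N n
  have h1 : c • (restrictLift φ N f * x) = 0 := by
    rw [← smul_mul_assoc, ← map_smul, ← hc', map_mul, hjs, mul_assoc, hNx, mul_zero]
  exact (smul_eq_zero.mp h1).resolve_left hc0

variable [N.Normal]

theorem map_mul_restrictLift (g : G) (a : MonoidAlgebra k N) :
    φ g * restrictLift φ N a = restrictLift φ N (conjAlgEquiv N g a) * φ g := by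
  induction a using MonoidAlgebra.induction_on with
  | of n => simp [conjAlgEquiv_single, restrictLift_single, ← map_mul]
  | add a b ha hb => simp only [map_add, mul_add, add_mul, ha, hb]
  | smul r a ha => simp only [map_smul, mul_smul_comm, smul_mul_assoc, ha]

variable [Fintype N] [NeZero (Nat.card N : k)]

/-- Let `f` be a rank one idempotent of `k[N]` whose stabilizer `S` in `G` satisfies that `S / N` is
generated by an element `t` and central elements `d` acting as scalars `δ d`. Then the corner
ring `f B f` is a quotient of `E[X]/(X ^ m - c δ(γ))`. -/
theorem IsRankOneIdempotent.exists_corner {f : MonoidAlgebra k N} (hf : IsRankOneIdempotent k f)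
    (hspan : Submodule.span E (Set.range φ) = ⊤) {D : Set G} {δ : G → E}
    (hD : ∀ d ∈ D, φ d = algebraMap E B (δ d)) {t γ : G} (ht : t ∈ hf.stabilizer N) {m : ℕ}
    (hγ : γ ∈ D) (htγ : ∃ h ∈ N, t ^ m = h * γ)
    (hgen : ∀ s ∈ hf.stabilizer N, ∃ h ∈ N, ∃ i : ℕ, ∃ d ∈ D, s = h * t ^ i * d)
    (hF0 : restrictLift φ N f ≠ 0) :
    ∃ T : B, Commute (restrictLift φ N f) T ∧
      (∃ c : k, c ≠ 0 ∧ T ^ m * restrictLift φ N f =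
        (algebraMap k E c * δ γ) • restrictLift φ N f) ∧
      ∀ b, ∃ q : E[X], restrictLift φ N f * b * restrictLift φ N f =
        aeval T q * restrictLift φ N f := by
  obtain ⟨a, ha⟩ := ht
  have hσ := hf.of_algEquiv (conjAlgEquiv N t)
  obtain ⟨v, hv, huv, hvu⟩ := hf.exists_inverse_mul hσ ha
  set u := f * a * conjAlgEquiv N t f with hu
  have hfu : f * u = u := by rw [hu, ← mul_assoc, ← mul_assoc, hf.mul_self]
  have huf : u * conjAlgEquiv N t f = u := by rw [hu, mul_assoc, hσ.mul_self]
  set j : MonoidAlgebra k N →ₐ[k] B := restrictLift φ N with hj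
  have hjφ (g : G) (x : MonoidAlgebra k N) : φ g * j x = j (conjAlgEquiv N g x) * φ g :=
    map_mul_restrictLift φ N g x
  set F := j f with hF
  have hFF : F * F = F := by rw [hF, ← map_mul, hf.mul_self]
  -- Multiplication by `φ t` carries `F` to the idempotent of the `t`-conjugate of `f`, and `u`
  -- brings it back. So `T` lies in the corner `F B F`; `T'` inverts it from the left there.
  set T := j u * φ t with hT
  set T' := φ t⁻¹ * j v with hT'
  have hFT : F * T = T := by rw [hT, hF, ← mul_assoc, ← map_mul, hfu]
  have hTF : T * F = T := by rw [hT, hF, mul_assoc, hjφ, ← mul_assoc, ← map_mul, huf]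
  have hcomm : Commute F T := by rw [Commute, SemiconjBy, hFT, hTF]
  have hT'T : T' * T = F := by
    rw [hT, hT', mul_assoc, ← mul_assoc (j v), ← map_mul, hvu, ← hjφ, ← mul_assoc, ← map_mul,
      inv_mul_cancel, map_one, one_mul]
  have hinv (i : ℕ) : T' ^ i * (T ^ i * F) = F := by
    induction i with
    | zero => simp
    | succ i ih =>
      calc T' ^ (i + 1) * (T ^ (i + 1) * F) = T' ^ i * ((T' * T) * T ^ i * F) := by
            rw [pow_succ, pow_succ']; simp only [mul_assoc]
        _ = T' ^ i * (T ^ i * (F * F)) := by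
            rw [hT'T, (hcomm.pow_right i).eq, mul_assoc]
        _ = F := by rw [hFF, ih]
  have hw (i : ℕ) : ∃ w, φ (t ^ i) * T' ^ i = j w := by
    induction i with
    | zero => exact ⟨1, by simp⟩
    | succ i ih =>
      obtain ⟨w, hw⟩ := ih
      refine ⟨conjAlgEquiv N (t ^ i) v * w, ?_⟩
      rw [map_mul, ← hw, ← mul_assoc, ← hjφ, pow_succ t, pow_succ', hT', map_mul, mul_assoc,
        mul_assoc, mul_assoc, ← mul_assoc (φ t), ← map_mul φ t, mul_inv_cancel, map_one, one_mul]
  -- Inserting `T' ^ i * T ^ i` turns `φ (t ^ i) * T' ^ i` into an element of the image of `k[N]`,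
  -- and the rank one property reduces that to a scalar.
  have hmono (x : MonoidAlgebra k N) (i : ℕ) :
      ∃ c : k, F * (j x * φ (t ^ i)) * F = c • (T ^ i * F) := by
    obtain ⟨w, hw⟩ := hw i
    obtain ⟨c, hc⟩ := hf.exists_smul (x * w)
    refine ⟨c, ?_⟩
    calc F * (j x * φ (t ^ i)) * F = F * (j x * (φ (t ^ i) * T' ^ i)) * (T ^ i * F) := by
          nth_rw 2 [← hinv i]; simp only [mul_assoc]
      _ = j (f * (x * w) * f) * T ^ i := by
          rw [hw, ← map_mul, ← (hcomm.pow_right i).eq, hF, ← map_mul, ← mul_assoc, ← map_mul]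
      _ = _ := by rw [hc, map_smul, smul_mul_assoc, ← hF, (hcomm.pow_right i).eq]
  have hpow (i : ℕ) : ∃ x, T ^ i * F = j x * φ (t ^ i) := by
    induction i with
    | zero => exact ⟨f, by simp [hF]⟩
    | succ i ih =>
      obtain ⟨x, hx⟩ := ih
      refine ⟨u * conjAlgEquiv N t x, ?_⟩
      rw [pow_succ', mul_assoc, hx, hT, mul_assoc, ← mul_assoc (φ t), hjφ, pow_succ' t, map_mul φ,
        map_mul j u, mul_assoc (j _) (φ t), mul_assoc]
  have hDcomm (d : G) (hd : d ∈ D) (x : B) : φ d * x = δ d • x := by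
    rw [hD d hd, Algebra.smul_def]
  have hDcomm' (d : G) (hd : d ∈ D) (x : B) : x * φ d = δ d • x := by
    rw [hD d hd, Algebra.smul_def, Algebra.commutes]
  refine ⟨T, hcomm, ?_, fun b => ?_⟩
  · obtain ⟨x, hx⟩ := hpow m
    obtain ⟨h, hh, hth⟩ := htγ
    obtain ⟨c, hc⟩ := hf.exists_smul (x * MonoidAlgebra.single ⟨h, hh⟩ 1)
    have h1 : T ^ m * F = (algebraMap k E c * δ γ) • F := by
      calc T ^ m * F = F * (T ^ m * F) * F := by
            rw [← (hcomm.pow_right m).eq, ← mul_assoc, hFF, mul_assoc, ← (hcomm.pow_right m).eq,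
              ← mul_assoc, hFF]
        _ = F * (j (x * MonoidAlgebra.single ⟨h, hh⟩ 1) * φ γ) * F := by
            rw [hx, hth, map_mul, map_mul, hj, restrictLift_single, mul_assoc (restrictLift φ N x)]
        _ = δ γ • j (f * (x * MonoidAlgebra.single ⟨h, hh⟩ 1) * f) := by
            rw [hDcomm' γ hγ, mul_smul_comm, smul_mul_assoc, hF, ← map_mul j f, ← map_mul j]
        _ = _ := by
            rw [hc, map_smul, mul_comm (algebraMap k E c), mul_smul, algebraMap_smul]
    refine ⟨c, ?_, h1⟩
    rintro rfl
    refine hF0 ?_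
    rw [map_zero, zero_mul, zero_smul] at h1
    -- `c = 0` would give `T ^ m * F = 0`, although `T ^ m` is left invertible on `F`.
    rw [← hinv m, h1, mul_zero]
  · have hb : b ∈ Submodule.span E (Set.range φ) := hspan ▸ Submodule.mem_top
    induction hb using Submodule.span_induction with
    | zero => exact ⟨0, by simp⟩
    | add x y _ _ hx hy =>
      obtain ⟨q, hq⟩ := hx
      obtain ⟨r, hr⟩ := hy
      exact ⟨q + r, by rw [mul_add, add_mul, hq, hr, map_add, add_mul]⟩
    | smul c x _ hx =>
      obtain ⟨q, hq⟩ := hx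
      exact ⟨c • q, by rw [mul_smul_comm, smul_mul_assoc, hq, map_smul, smul_mul_assoc]⟩
    | mem x hx =>
      obtain ⟨s, rfl⟩ := hx
      by_cases hs : s ∈ hf.stabilizer N
      · obtain ⟨h, hh, i, d, hd, rfl⟩ := hgen s hs
        obtain ⟨c, hc⟩ := hmono (MonoidAlgebra.single ⟨h, hh⟩ 1) i
        refine ⟨C (δ d * algebraMap k E c) * X ^ i, ?_⟩
        rw [map_mul, hDcomm' d hd, mul_smul_comm, smul_mul_assoc, map_mul φ h]
        rw [hj, restrictLift_single] at hc
        rw [hc, map_mul, aeval_C, map_pow, aeval_X, mul_assoc, ← Algebra.smul_def, mul_smul,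
          algebraMap_smul]
      -- Elements outside the stabilizer contribute nothing to the corner.
      · rw [hf.mem_stabilizer] at hs
        push Not at hs
        refine ⟨0, ?_⟩
        have := hs 1
        rw [map_zero, zero_mul, mul_assoc, hF, hjφ, ← mul_assoc, ← map_mul]
        rw [mul_one] at this
        rw [this, map_zero, zero_mul]

/-- The corner is a quotient of the field `E[X]/(g)`: an element given by a polynomial prime to `g`
is invertible there by Bézout, so it is not nilpotent unless `F = 0`. -/
theorem eq_zero_of_sq_eq_zero_of_corner {F T : B} (hFF : F * F = F) {g : E[X]}
    (hg : Irreducible g) (hgT : aeval T g * F = 0)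
    (hspan : ∀ b, ∃ q : E[X], F * b * F = aeval T q * F) {y : B} (hy : F * y * F = y)
    (hyy : y * y = 0) : y = 0 := by
  obtain ⟨q, hq⟩ := hspan y
  rw [hy] at hq
  by_cases hdvd : g ∣ q
  · obtain ⟨r, rfl⟩ := hdvd
    rw [hq, mul_comm, map_mul, mul_assoc, hgT, mul_zero]
  · obtain ⟨a, b, hab⟩ := (hg.coprime_iff_not_dvd).mpr hdvd
    have h1 : aeval T b * y = F := by
      have := congrArg (fun r => aeval T r * F) hab
      simp only [map_add, map_mul, add_mul, map_one, one_mul, mul_assoc] at this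
      rwa [hgT, mul_zero, zero_add, ← hq] at this
    have hyF : F * y = y := by rw [← hy, ← mul_assoc, ← mul_assoc, hFF]
    rw [← hyF, ← h1, mul_assoc, hyy, mul_zero]

/-- The corner ring of a nontrivial rank one idempotent is reduced. -/
theorem IsRankOneIdempotent.corner_reduced {p : ℕ} (hp : p.Prime) (hp2 : p ≠ 2)
    (hspan : Submodule.span E (Set.range φ) = ⊤) {D H : Subgroup G}
    (hDc : D ≤ Subgroup.center G) {δ : G → E}
    (hD : ∀ d ∈ D, φ d = algebraMap E B (δ d)) {γ : G} (hγ : γ ∈ D)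
    (hγp : ∀ c : k, c ≠ 0 → ∀ b : E, b ^ p ≠ algebraMap k E c * δ γ)
    (hHN : ∀ h ∈ H, h ∉ N → ∀ n ∈ N, ∃ m ∈ N, m * h * m⁻¹ = n * h)
    (hgen : ∀ S : Subgroup G, D ≤ S → ∃ t ∈ S, (∃ n : ℕ, ∃ h ∈ H, t ^ p ^ n = h * γ) ∧
      ∀ s ∈ S, ∃ h ∈ H, ∃ i : ℕ, ∃ d ∈ D, s = h * t ^ i * d)
    {f : MonoidAlgebra k N} (hf : IsRankOneIdempotent k f)
    (hf0 : (∑ n : N, MonoidAlgebra.single n (1 : k)) * f = 0) {y : B}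
    (hy : restrictLift φ N f * y * restrictLift φ N f = y) (hyy : y * y = 0) : y = 0 := by
  by_cases hF0 : restrictLift φ N f = 0
  · rw [← hy, hF0, mul_zero]
  have hDS : D ≤ hf.stabilizer N := fun d hd => ⟨1, by
    rw [conjAlgEquiv_of_mem_center N (hDc hd), mul_one, hf.mul_self]
    exact hf.ne_zero⟩
  -- The Frobenius hypothesis enters here: the stabilizer meets `H` only inside `N`.
  have hSH {h : G} (hh : h ∈ H) (hhS : h ∈ hf.stabilizer N) : h ∈ N := by
    by_contra hhN
    obtain ⟨a, ha⟩ := hhS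
    exact ha (hf.mul_conjAlgEquiv_eq_zero N hf0 (hHN h hh hhN) a)
  obtain ⟨t, ht, ⟨n, h, hh, hth⟩, hS⟩ := hgen _ hDS
  have hhN : h ∈ N := hSH hh (by
    rw [eq_mul_inv_of_mul_eq hth.symm]
    exact mul_mem (pow_mem ht _) (inv_mem (hDS hγ)))
  obtain ⟨T, hT, ⟨c, hc0, hc⟩, hb⟩ := hf.exists_corner φ N hspan (D := D) hD ht hγ ⟨h, hhN, hth⟩
    (fun s hs => by
      obtain ⟨h, hh, i, d, hd, rfl⟩ := hS s hs
      refine ⟨h, hSH hh ?_, i, d, hd, rfl⟩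
      rwa [Subgroup.mul_mem_cancel_right _ (hDS hd),
        Subgroup.mul_mem_cancel_right _ (pow_mem ht _)] at hs) hF0
  refine eq_zero_of_sq_eq_zero_of_corner (g := X ^ p ^ n - C (algebraMap k E c * δ γ))
    (by rw [← map_mul, hf.mul_self]) ?_ ?_ hb hy hyy
  -- For an odd prime, irreducibility of `X ^ p ^ n - a` only needs that `a` is not a `p`-th power.
  · exact X_pow_sub_C_irreducible_of_prime_pow hp hp2 n fun b => hγp c hc0 b
  · rw [map_sub, map_pow, aeval_X, aeval_C, sub_mul, hc, Algebra.smul_def, sub_self]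

omit [Algebra k E] [IsScalarTower k E B] in
/-- If `x B x = 0` and the corner ring of `f` is reduced, then `f x f' = 0`. -/
theorem IsRankOneIdempotent.mul_mul_eq_zero {f f' : MonoidAlgebra k N}
    (hspan : Submodule.span E (Set.range φ) = ⊤)
    (hf : IsRankOneIdempotent k f) (hf' : IsRankOneIdempotent k f')
    (hred : ∀ y : B, restrictLift φ N f * y * restrictLift φ N f = y → y * y = 0 → y = 0)
    {x : B} (hx : ∀ b, x * b * x = 0) : restrictLift φ N f * x * restrictLift φ N f' = 0 := by
  by_contra hy0
  -- Otherwise `F B F' = 0`, since `φ` spans `B`. Such a `g` links `f` to a conjugate of `f'`, which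
  -- allows `F x F'` to be moved into the corner at `F`.
  have hg : ∃ g : G, restrictLift φ N f * φ g * restrictLift φ N f' ≠ 0 := by
    by_contra! hg
    refine hy0 ?_
    have hb : x ∈ Submodule.span E (Set.range φ) := hspan ▸ Submodule.mem_top
    clear hx hy0
    induction hb using Submodule.span_induction with
    | zero => simp
    | add x y _ _ hx hy => rw [mul_add, add_mul, hx, hy, add_zero]
    | smul c x _ hx => rw [mul_smul_comm, smul_mul_assoc, hx, smul_zero]
    | mem x hx => obtain ⟨g, rfl⟩ := hx; exact hg g
  obtain ⟨g, hg⟩ := hg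
  have hu0 : f * 1 * conjAlgEquiv N g f' ≠ 0 := by
    intro h
    rw [mul_one] at h
    rw [mul_assoc, map_mul_restrictLift, ← mul_assoc, ← map_mul, h, map_zero, zero_mul] at hg
    exact hg rfl
  have hσ := hf'.of_algEquiv (conjAlgEquiv N g)
  obtain ⟨v, hv, -, hvu⟩ := hf.exists_inverse_mul hσ hu0
  have hvf : v * f = v := by rw [← hv, mul_assoc, hf.mul_self]
  have h2 : φ g⁻¹ * restrictLift φ N v * restrictLift φ N (f * 1 * conjAlgEquiv N g f') * φ g =
      restrictLift φ N f' := by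
    rw [mul_assoc (φ g⁻¹), ← map_mul, hvu, map_mul_restrictLift, ← conjAlgEquiv_mul,
      inv_mul_cancel, conjAlgEquiv_of_mem_center N (Subgroup.one_mem _), mul_assoc, ← map_mul,
      inv_mul_cancel, map_one, mul_one]
  generalize hFe : restrictLift φ N f = F at *
  generalize hFe' : restrictLift φ N f' = F' at *
  have hFF : F * F = F := by rw [← hFe, ← map_mul, hf.mul_self]
  have hFF' : F' * F' = F' := by rw [← hFe', ← map_mul, hf'.mul_self]
  have hVF : restrictLift φ N v * F = restrictLift φ N v := by rw [← hFe, ← map_mul, hvf]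
  -- The square of this corner element contains a factor of the form `x * b * x`.
  have hz : F * x * F' * φ g⁻¹ * restrictLift φ N v = 0 := by
    refine hred _ ?_ ?_
    · calc _ = (F * F) * x * F' * φ g⁻¹ * (restrictLift φ N v * F) := by simp only [mul_assoc]
        _ = _ := by rw [hFF, hVF]
    · calc _ = F * (x * (F' * φ g⁻¹ * restrictLift φ N v * F) * x) *
              (F' * φ g⁻¹ * restrictLift φ N v) := by simp only [mul_assoc]
        _ = 0 := by rw [hx, mul_zero, zero_mul]
  refine hy0 ?_
  calc F * x * F' = F * x * F' * F' := by rw [mul_assoc _ F' F', hFF']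
    _ = (F * x * F' * φ g⁻¹ * restrictLift φ N v) *
        (restrictLift φ N (f * 1 * conjAlgEquiv N g f') * φ g) := by
      nth_rw 2 [← h2]; simp only [mul_assoc]
    _ = 0 := by rw [hz, zero_mul]

/-- Semiprimeness of the part of a twisted group algebra on which a normal subgroup `N` has no
trivial constituents. -/
theorem eq_zero_of_forall_mul_mul_eq_zero [IsAlgClosed k] {p : ℕ} (hp : p.Prime) (hp2 : p ≠ 2)
    (hspan : Submodule.span E (Set.range φ) = ⊤) {D H : Subgroup G}
    (hDc : D ≤ Subgroup.center G) {δ : G → E}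
    (hD : ∀ d ∈ D, φ d = algebraMap E B (δ d)) {γ : G} (hγ : γ ∈ D)
    (hγp : ∀ c : k, c ≠ 0 → ∀ b : E, b ^ p ≠ algebraMap k E c * δ γ)
    (hHN : ∀ h ∈ H, h ∉ N → ∀ n ∈ N, ∃ m ∈ N, m * h * m⁻¹ = n * h)
    (hgen : ∀ S : Subgroup G, D ≤ S → ∃ t ∈ S, (∃ n : ℕ, ∃ h ∈ H, t ^ p ^ n = h * γ) ∧
      ∀ s ∈ S, ∃ h ∈ H, ∃ i : ℕ, ∃ d ∈ D, s = h * t ^ i * d)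
    {x : B} (hx : ∀ b, x * b * x = 0) (hNx : (∑ n : N, φ n) * x = 0) : x = 0 := by
  obtain ⟨ι, _, f, hf1, hf⟩ := exists_sum_isRankOneIdempotent k (MonoidAlgebra k N)
  have hsum : ∑ i, restrictLift φ N (f i) = 1 := by rw [← map_sum, hf1, map_one]
  have hij (i l : ι) : restrictLift φ N (f i) * x * restrictLift φ N (f l) = 0 := by
    by_cases hi : (∑ n : N, MonoidAlgebra.single n (1 : k)) * f i = 0
    · exact (hf i).mul_mul_eq_zero φ N hspan (hf l) (fun y => (hf i).corner_reduced φ N hp hp2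
        hspan hDc hD hγ hγp hHN hgen hi) hx
    · rw [(hf i).restrictLift_mul_eq_zero φ N hi hNx, zero_mul]
  calc x = (∑ i, restrictLift φ N (f i)) * x * ∑ l, restrictLift φ N (f l) := by
        rw [hsum, one_mul, mul_one]
    _ = ∑ i, ∑ l, restrictLift φ N (f i) * x * restrictLift φ N (f l) := by
      rw [Finset.sum_mul, Finset.sum_mul]
      exact Finset.sum_congr rfl fun i _ => Finset.mul_sum _ _ _
    _ = 0 := by simp [hij]

end Corner

section

open Polynomial

/-! ### Traces of integral matrices. -/

section TraceIntegrality

variable {R : Type*} [CommRing R]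

theorem aeval_eq_zero_of_mem_roots_charpoly {n K : Type*} [Fintype n] [DecidableEq n] [Field K]
    [Algebra R K] {A : Matrix n n R} {q : R[X]} (hq : aeval A q = 0) {μ : K}
    (hμ : μ ∈ (Matrix.toLin' (A.map (algebraMap R K))).charpoly.roots) : aeval μ q = 0 := by
  have h1 : aeval (A.map (algebraMap R K)) q = 0 := by
    have := congrArg ((Algebra.ofId R K).mapMatrix (m := n)) hq
    rw [← aeval_algHom_apply, map_zero] at this
    exact this
  have h2 : aeval (Matrix.toLin' (A.map (algebraMap R K))) (q.map (algebraMap R K)) = 0 := by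
    have := congrArg (Matrix.toLinAlgEquiv' (R := K) (n := n)).toAlgHom h1
    rw [map_zero, ← aeval_map_algebraMap K, ← aeval_algHom_apply] at this
    exact this
  have h3 := (Module.End.hasEigenvalue_iff_isRoot_charpoly _ μ).mpr (mem_roots'.mp hμ).2
  obtain ⟨v, hv⟩ := h3.exists_hasEigenvector
  have h4 := Module.End.aeval_apply_of_hasEigenvector (p := q.map (algebraMap R K)) hv
  rw [h2, LinearMap.zero_apply, eq_comm, smul_eq_zero] at h4
  rw [← aeval_map_algebraMap K, aeval_def, eval₂_eq_eval_map]
  simpa using h4.resolve_right hv.2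

/-- If `r⁻¹ A` is integral over the integrally closed domain `R`, then `r` divides the trace
of `A`. -/
theorem dvd_trace_of_aeval_scaleRoots [IsDomain R] [IsIntegrallyClosed R] {n : Type*} [Fintype n]
    [DecidableEq n] {A : Matrix n n R} {q : R[X]} (hqm : q.Monic) {r : R} (hr : r ≠ 0)
    (hq : aeval A (q.scaleRoots r) = 0) : r ∣ A.trace := by
  let K := AlgebraicClosure (FractionRing R)
  have hinj : Function.Injective (algebraMap R K) := by
    rw [IsScalarTower.algebraMap_eq R (FractionRing R) K]
    exact (algebraMap (FractionRing R) K).injective.comp (IsFractionRing.injective R _)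
  have hrK : algebraMap R K r ≠ 0 := (map_ne_zero_iff _ hinj).mpr hr
  have htr : algebraMap R K A.trace =
      (Matrix.toLin' (A.map (algebraMap R K))).charpoly.roots.sum := by
    rw [← Module.End.trace_eq_sum_roots_charpoly_of_splits (IsAlgClosed.splits _),
      Matrix.trace_toLin'_eq, AddMonoidHom.map_trace]
  -- Every eigenvalue of `A` divided by `r` is a root of the monic `q`, so the sum of these
  -- quotients is integral.
  have hint : IsIntegral R (algebraMap R K A.trace / algebraMap R K r) := by
    rw [htr, div_eq_mul_inv, ← Multiset.map_id (roots _), ← Multiset.sum_map_mul_right]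
    refine IsIntegral.multiset_sum fun x hx => ?_
    obtain ⟨μ, hμ, rfl⟩ := Multiset.mem_map.mp hx
    have h1 := aeval_eq_zero_of_mem_roots_charpoly hq hμ
    refine ⟨q, hqm, ?_⟩
    have h2 := scaleRoots_eval₂_mul (algebraMap R K) (μ * (algebraMap R K r)⁻¹) r (p := q)
    rw [mul_comm μ, mul_inv_cancel_left₀ hrK, ← aeval_def, h1, eq_comm, mul_eq_zero] at h2
    rw [mul_comm]
    exact h2.resolve_left (pow_ne_zero _ hrK)
  have h3 : IsIntegral R (algebraMap R (FractionRing R) A.trace /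
      algebraMap R (FractionRing R) r) := by
    rw [← isIntegral_algebraMap_iff (algebraMap (FractionRing R) K).injective, map_div₀,
      ← IsScalarTower.algebraMap_apply, ← IsScalarTower.algebraMap_apply]
    exact hint
  obtain ⟨c, hc⟩ := IsIntegrallyClosed.isIntegral_iff.mp h3
  refine ⟨c, IsFractionRing.injective R (FractionRing R) ?_⟩
  rw [map_mul, hc, mul_div_cancel₀]
  exact (map_ne_zero_iff _ (IsFractionRing.injective R _)).mpr hr

end TraceIntegrality

/-! ### The total ring of fractions over a central domain. -/

section Fractions

variable {L : Type*} [Ring L]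

theorem toFractions_injective : Function.Injective (toFractions L) := by
  rw [injective_iff_map_eq_zero]
  intro x hx
  have h : LocalizedModule.mk x (1 : centralRegular L) = LocalizedModule.mk 0 1 := by
    rw [LocalizedModule.zero_mk]; exact hx
  obtain ⟨u, hu⟩ := LocalizedModule.mk_eq.mp h
  simp only [one_smul, smul_zero] at hu
  exact (mem_nonZeroDivisors_iff.mp u.2).1 x hu

variable {R : Type*} [CommRing R] [Algebra R L]

theorem algebraMap_mul_fraction (r : R) (x : L) (s : centralRegular L) :
    r • fraction x s = fraction (r • x) s := by
  rw [Algebra.smul_def, Algebra.smul_def]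
  refine (LocalizedModule.mk_mul_mk).trans ?_
  rw [one_mul]; rfl

theorem smul_toFractions (r : R) (x : L) : r • toFractions L x = toFractions L (r • x) :=
  algebraMap_mul_fraction r x 1

theorem exists_eq_fraction (x : TotalFractionRing L) : ∃ a s, x = fraction a s := by
  induction x using LocalizedModule.induction_on with
  | h m s => exact ⟨m, s, rfl⟩

theorem fraction_mul_left (s : centralRegular L) (x : L) :
    fraction ((s : Subring.center L) * x : L) s = toFractions L x :=
  LocalizedModule.mk_cancel s x

theorem eq_zero_of_smul_eq_zero_fractions [IsDomain R] [Module.IsTorsionFree R L] {r : R}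
    (hr : r ≠ 0) {x : TotalFractionRing L} (h : r • x = 0) : x = 0 := by
  obtain ⟨a, s, rfl⟩ := exists_eq_fraction x
  rw [algebraMap_mul_fraction] at h
  have h' : LocalizedModule.mk (r • a) s = LocalizedModule.mk 0 1 := by
    rw [LocalizedModule.zero_mk]; exact h
  obtain ⟨u, hu⟩ := LocalizedModule.mk_eq.mp h'
  simp only [one_smul, smul_zero] at hu
  have h1 : r • a = 0 := (mem_nonZeroDivisors_iff.mp u.2).1 _ hu
  rw [(smul_eq_zero.mp h1).resolve_left hr]
  exact LocalizedModule.zero_mk s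

/-- Take a monic equation of `s` over `R` and strip off the powers of `X`, which is allowed because
`s` is regular. The remaining constant term is nonzero and is a multiple of `s`. -/
theorem exists_mul_eq_algebraMap [IsDomain R] [Module.Finite R L] {s : L}
    (hs : s ∈ nonZeroDivisors L) : ∃ r : R, r ≠ 0 ∧ ∃ s' : L, s * s' = algebraMap R L r := by
  obtain ⟨p, hpm, hp⟩ := IsIntegral.of_finite R s
  rw [← aeval_def] at hp
  obtain ⟨q, hq, hdvd⟩ := exists_eq_pow_rootMultiplicity_mul_and_not_dvd p hpm.ne_zero 0
  rw [C_0, sub_zero, X_dvd_iff] at hdvd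
  rw [C_0, sub_zero] at hq
  rw [hq, map_mul, map_pow, aeval_X] at hp
  have h1 := (mem_nonZeroDivisors_iff.mp (pow_mem hs _)).1 _ hp
  refine ⟨q.coeff 0, hdvd, -aeval s q.divX, ?_⟩
  rw [← X_mul_divX_add q, map_add, map_mul, aeval_X, aeval_C] at h1
  rw [mul_neg, neg_eq_iff_add_eq_zero, h1]

/-- If `L` is finite over the domain `R`, then every fraction has a denominator in `R`. -/
theorem exists_smul_eq_toFractions [IsDomain R] [Module.Finite R L] (x : TotalFractionRing L) :
    ∃ r : R, r ≠ 0 ∧ ∃ a : L, r • x = toFractions L a := by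
  obtain ⟨a, s, rfl⟩ := exists_eq_fraction x
  obtain ⟨r, hr, s', hs'⟩ := exists_mul_eq_algebraMap (R := R) s.2
  refine ⟨r, hr, s' * a, ?_⟩
  rw [algebraMap_mul_fraction, Algebra.smul_def, ← hs', mul_assoc]
  exact fraction_mul_left s _

end Fractions

/-! ### Bounding orders by the trace, and the maximality criterion. -/

section Orders

variable {R A : Type*} [CommRing R] [Ring A] [Algebra R A]

/-- Cayley–Hamilton for right multiplication by `x` on the finitely generated module `M`. As the
identity of `M` is `e`, this only gives `e q(x) = 0`; multiplying `q` by `X` removes the `e`. -/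
theorem IsOrder.isIntegral {e : A} {M : Submodule R A} (hM : IsOrder R e M) {x : A} (hx : x ∈ M) :
    IsIntegral R x := by
  have : Module.Finite R M := Module.Finite.of_fg hM.fg
  let f : Module.End R M :=
    ((LinearMap.mulRight R x).comp M.subtype).codRestrict M fun m => hM.mul_mem _ m.2 _ hx
  obtain ⟨q, hqm, hq⟩ := LinearMap.exists_monic_and_aeval_eq_zero R f
  have h (m : M) (q : R[X]) : ((aeval f q m : M) : A) = m * aeval x q := by
    induction q using Polynomial.induction_on' with
    | add p q hp hq => simp [mul_add, hp, hq]
    | monomial n a =>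
      have h1 : ((f ^ n) m : A) = m * x ^ n := by
        induction n with
        | zero => simp
        | succ n ih =>
          rw [pow_succ', Module.End.mul_apply, pow_succ, ← mul_assoc, ← ih]
          rfl
      rw [← C_mul_X_pow_eq_monomial, map_mul, map_mul, aeval_C, aeval_C, map_pow, map_pow, aeval_X,
        aeval_X, Module.End.mul_apply, Module.algebraMap_end_apply, Submodule.coe_smul, h1,
        ← Algebra.smul_def, mul_smul_comm]
  have h2 : e * aeval x q = 0 := by
    rw [← h ⟨e, hM.one_mem⟩, hq]; rfl
  refine ⟨X * q, monic_X.mul hqm, ?_⟩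
  rw [← aeval_def, map_mul, aeval_X, ← hM.le x hx, mul_assoc, hM.le x hx, h2, mul_zero]

variable {L : Type*} [Ring L] [Algebra R L] [IsDomain R] [IsIntegrallyClosed R]

theorem dvd_trace_leftMulMatrix {ι : Type*} [Fintype ι] [DecidableEq ι] (b : Module.Basis ι R L)
    {x : TotalFractionRing L} (hx : IsIntegral R x) {r : R} (hr : r ≠ 0) {a : L}
    (ha : r • x = toFractions L a) : r ∣ (Algebra.leftMulMatrix b a).trace := by
  obtain ⟨q, hqm, hq⟩ := hx
  refine dvd_trace_of_aeval_scaleRoots hqm hr ?_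
  rw [aeval_algHom_apply]
  have h1 : aeval (toFractionsₐ L R a) (q.scaleRoots r) = 0 := by
    rw [show toFractionsₐ L R a = algebraMap R _ r * x by rw [← Algebra.smul_def, ha]; rfl]
    exact scaleRoots_aeval_eq_zero hq
  rw [aeval_algHom_apply] at h1
  rw [toFractions_injective (h1.trans (map_zero (toFractions L)).symm), map_zero]

/-- Orders in the fraction ring of a group-ring-like algebra are contained in the scaled down
algebra. Here `L` has an `R`-basis `g w` of units with dual basis `a ↦ T (a * (g w)⁻¹)`. -/
theorem exists_smul_eq_toFractions_of_isOrder {ι : Type*} [Fintype ι] (g : ι → Lˣ) (T : L → R)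
    (b : Module.Basis ι R L) (hb : ∀ w, b w = g w)
    (hT : ∀ a w, b.repr a w = T (a * ↑(g w)⁻¹)) {e : L} {M : Submodule R (TotalFractionRing L)}
    (hM : IsOrder R (toFractions L e) M) (he : ∀ a, toFractions L (a * e) ∈ M)
    (hcomm : ∀ a, e * a = a * e) {x : TotalFractionRing L} (hx : x ∈ M) :
    ∃ a, (Fintype.card ι : R) • x = toFractions L a := by
  classical
  have := Module.Finite.of_basis b
  have : Module.Free R L := Module.Free.of_basis b
  obtain ⟨r, hr, a, ha⟩ := exists_smul_eq_toFractions (R := R) x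
  -- Each diagonal entry is `T (a * g w * (g w)⁻¹) = T a`.
  have htr (a : L) : (Algebra.leftMulMatrix b a).trace = Fintype.card ι * T a := by
    simp only [Matrix.trace, Matrix.diag, Algebra.leftMulMatrix_eq_repr_mul, hT, hb, mul_assoc,
      Units.mul_inv, mul_one, Finset.sum_const, Finset.card_univ, nsmul_eq_mul]
  -- The coordinate of `a` at `w` is the trace coefficient of `a * (g w)⁻¹`, and `x * (g w)⁻¹ * e`
  -- is integral because it lies in `M`.
  have hdvd (w : ι) : r ∣ Fintype.card ι * b.repr a w := by
    rw [hT, ← htr]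
    refine dvd_trace_leftMulMatrix b (x := x * toFractions L (↑(g w)⁻¹ * e)) ?_ hr ?_
    · exact hM.isIntegral (hM.mul_mem _ hx _ (he _))
    · rw [← smul_mul_assoc, ha, ← map_mul, ← hcomm, ← mul_assoc]
      congr 2
      refine toFractions_injective ?_
      rw [map_mul, ← ha, smul_mul_assoc, hM.le x hx]
  choose c hc using hdvd
  refine ⟨∑ w, c w • b w, ?_⟩
  rw [← sub_eq_zero]
  refine eq_zero_of_smul_eq_zero_fractions hr ?_
  rw [smul_sub, sub_eq_zero, smul_comm, ha, smul_toFractions, smul_toFractions]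
  congr 1
  rw [Finset.smul_sum]
  nth_rw 1 [← b.sum_repr a]
  rw [Finset.smul_sum]
  exact Finset.sum_congr rfl fun w _ => by rw [smul_smul, smul_smul, hc]

omit [IsIntegrallyClosed R] in
theorem isOrder_range [Module.Finite R L] {e : L} (he : e * e = e) (hcomm : ∀ a, e * a = a * e) :
    IsOrder R (toFractions L e) ((LinearMap.mulRight R (toFractions L e)).comp
      (toFractionsₐ L R).toLinearMap).range where
  le := by
    rintro _ ⟨a, rfl⟩
    change toFractions L a * toFractions L e * toFractions L e = toFractions L a * toFractions L e
    rw [← map_mul, ← map_mul, mul_assoc, he]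
  one_mem := ⟨1, by
    change toFractions L 1 * toFractions L e = toFractions L e
    rw [map_one, one_mul]⟩
  mul_mem := by
    rintro _ ⟨a, rfl⟩ _ ⟨b, rfl⟩
    refine ⟨a * b, ?_⟩
    change toFractions L (a * b) * toFractions L e =
      toFractions L a * toFractions L e * (toFractions L b * toFractions L e)
    simp only [← map_mul]
    rw [mul_assoc a e, ← mul_assoc e b, hcomm b, mul_assoc b, he, mul_assoc]
  fg := by
    rw [LinearMap.range_eq_map]
    exact Module.Finite.fg_top.map _
  full x := by
    obtain ⟨r, hr, a, ha⟩ := exists_smul_eq_toFractions (R := R) x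
    refine ⟨r, mem_nonZeroDivisors_of_ne_zero hr, a, ?_⟩
    change toFractions L a * toFractions L e = r • (x * toFractions L e)
    rw [← smul_mul_assoc, ha]

/-- A criterion for `L e` to be a maximal order: `L` has an `R`-basis of units as above, and
the reduction of `L e` modulo `p` is semiprime. -/
theorem isMaximalOrder_range {ι : Type*} [Fintype ι] (g : ι → Lˣ) (T : L → R)
    (b : Module.Basis ι R L) (hb : ∀ w, b w = g w)
    (hT : ∀ a w, b.repr a w = T (a * ↑(g w)⁻¹)) {e : L} (he : e * e = e)
    (hcomm : ∀ a, e * a = a * e) {p : ℕ} (hp0 : (p : R) ≠ 0)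
    (hcard : ∃ (n : ℕ) (u : Rˣ), (Fintype.card ι : R) = p ^ n * u)
    (hsemi : ∀ a : L, a * e = a → (∀ c, (p : L) ∣ a * c * a) → (p : L) ∣ a) :
    IsMaximalOrder R (toFractions L e) ((LinearMap.mulRight R (toFractions L e)).comp
      (toFractionsₐ L R).toLinearMap).range := by
  classical
  have := Module.Finite.of_basis b
  have : Module.Free R L := Module.Free.of_basis b
  refine ⟨isOrder_range he hcomm, fun M hM hle => ?_⟩
  have heM (a : L) : toFractions L (a * e) ∈ M := hle ⟨a, (map_mul (toFractions L) a e).symm⟩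
  have hpow : ∃ n : ℕ, ∀ x ∈ M, ∃ a, (p : R) ^ n • x = toFractions L a := by
    obtain ⟨n, u, hu⟩ := hcard
    refine ⟨n, fun x hx => ?_⟩
    obtain ⟨a, ha⟩ := exists_smul_eq_toFractions_of_isOrder g T b hb hT hM heM hcomm hx
    refine ⟨(↑u⁻¹ : R) • a, ?_⟩
    rw [← smul_toFractions, ← ha, hu, smul_smul, mul_comm, mul_assoc, Units.mul_inv, mul_one]
  classical
  -- If the least exponent were `n + 1`, an `x ∈ M` with `p ^ n x` outside `L` would give `a = p ^
  -- (n + 1) x` in `L`. Then `a c a = p ^ (n + 1) (p ^ (n + 1) x c x)` is divisible by `p`, and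
  -- semiprimeness makes `a` divisible by `p`, a contradiction.
  have hzero : Nat.find hpow = 0 := by
    by_contra hn
    obtain ⟨n, hn⟩ := Nat.exists_eq_succ_of_ne_zero hn
    have hmin : ¬ ∀ x ∈ M, ∃ a, (p : R) ^ n • x = toFractions L a :=
      Nat.find_min hpow (by omega)
    have hfind := Nat.find_spec hpow
    rw [hn] at hfind
    push Not at hmin
    obtain ⟨x, hx, hxn⟩ := hmin
    obtain ⟨a, ha⟩ := hfind x hx
    have hdvd : (p : L) ∣ a := by
      refine hsemi a (toFractions_injective ?_) fun c => ?_
      · rw [map_mul, ← ha, smul_mul_assoc, hM.le x hx]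
      · obtain ⟨d, hd⟩ := hfind _ (hM.mul_mem _ (hM.mul_mem _ hx _ (heM c)) _ hx)
        refine ⟨(p : R) ^ n • d, toFractions_injective ?_⟩
        have hxe : x * toFractions L (c * e) * x = x * toFractions L c * x := by
          rw [← hcomm, map_mul, ← mul_assoc, hM.le x hx]
        calc toFractions L (a * c * a)
            = (p : R) ^ (n + 1) • (p : R) ^ (n + 1) • (x * toFractions L c * x) := by
              rw [map_mul, map_mul, ← ha, smul_mul_assoc, smul_mul_assoc, mul_smul_comm]
          _ = (p : R) ^ (n + 1) • toFractions L d := by rw [← hxe, hd]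
          _ = toFractions L (p * ((p : R) ^ n • d)) := by
              rw [smul_toFractions, pow_succ', mul_smul, Algebra.smul_def (p : R), map_natCast]
    obtain ⟨d, rfl⟩ := hdvd
    refine hxn d ?_
    rw [← sub_eq_zero]
    refine eq_zero_of_smul_eq_zero_fractions hp0 ?_
    rw [smul_sub, smul_smul, ← pow_succ', ha, smul_toFractions, Algebra.smul_def (p : R),
      map_natCast, sub_self]
  intro x hx
  obtain ⟨a, ha⟩ := Nat.find_spec hpow x hx
  rw [hzero, pow_zero, one_smul] at ha
  refine ⟨a, ?_⟩
  change toFractions L a * toFractions L e = x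
  rw [← ha, hM.le x hx]

end Orders

end

section

open Polynomial

/-! ### The polynomials `(1 + X) ^ (p ^ n) - 1` in `ℤ_p[[X]]`. -/

section Omega

variable (p : ℕ) [Fact p.Prime]

/-- The polynomial `(1 + X) ^ (p ^ n) - 1` over `ℤ_p`. -/
def omegaPoly (n : ℕ) : ℤ_[p][X] := (X + 1) ^ p ^ n - 1

theorem omegaPoly_monic (n : ℕ) : (omegaPoly p n).Monic ∧ (omegaPoly p n).natDegree = p ^ n := by
  have h1 : ((X + 1 : ℤ_[p][X]) ^ p ^ n).Monic := (monic_X_add_C (1 : ℤ_[p])).pow _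
  have h2 : ((X + 1 : ℤ_[p][X]) ^ p ^ n).natDegree = p ^ n := by
    have := (monic_X_add_C (1 : ℤ_[p])).natDegree_pow (p ^ n)
    rwa [natDegree_X_add_C, mul_one, C_1] at this
  have h0 : 0 < p ^ n := pow_pos (Fact.out : p.Prime).pos n
  have h3 : (1 : ℤ_[p][X]).degree < ((X + 1 : ℤ_[p][X]) ^ p ^ n).degree := by
    rw [degree_eq_natDegree h1.ne_zero, h2, degree_one]
    exact_mod_cast h0
  refine ⟨h1.sub_of_left h3, ?_⟩
  rw [omegaPoly, natDegree_sub_eq_left_of_natDegree_lt, h2]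
  rw [h2, natDegree_one]; exact h0

theorem omegaPoly_isDistinguishedAt (n : ℕ) :
    (omegaPoly p n).IsDistinguishedAt (IsLocalRing.maximalIdeal ℤ_[p]) where
  monic := (omegaPoly_monic p n).1
  mem {i} hi := by
    rw [(omegaPoly_monic p n).2] at hi
    rw [PadicInt.maximalIdeal_eq_span_p, Ideal.mem_span_singleton, omegaPoly, coeff_sub,
      coeff_X_add_one_pow]
    rcases eq_or_ne i 0 with rfl | h0
    · simp
    · rw [coeff_one, if_neg h0, sub_zero]
      exact_mod_cast Nat.cast_dvd_cast
        ((Fact.out : p.Prime).dvd_choose_pow h0 hi.ne)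

theorem coe_omegaPoly (n : ℕ) :
    (omegaPoly p n : PowerSeries ℤ_[p]) = (PowerSeries.X + 1) ^ p ^ n - 1 := by
  simp [omegaPoly]

/-- Division with remainder by `omegaPoly`. -/
theorem exists_eq_omegaPoly_mul_add (n : ℕ) (F : PowerSeries ℤ_[p]) :
    ∃ (h : PowerSeries ℤ_[p]) (r : ℤ_[p][X]), r.degree < (omegaPoly p n).degree ∧
      F = (omegaPoly p n : PowerSeries ℤ_[p]) * h + r := by
  obtain ⟨q, hq⟩ := (omegaPoly_isDistinguishedAt p n).algEquivQuotient.surjective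
    (Ideal.Quotient.mk _ F)
  obtain ⟨q, rfl⟩ := Ideal.Quotient.mk_surjective q
  have h1 : Ideal.Quotient.mk (Ideal.span {(omegaPoly p n : PowerSeries ℤ_[p])})
      (q : PowerSeries ℤ_[p]) = Ideal.Quotient.mk _ F := by
    rw [← hq]; simp
  obtain ⟨h, hh⟩ := Ideal.mem_span_singleton.mp (Ideal.Quotient.eq.mp h1.symm)
  refine ⟨h + (q /ₘ omegaPoly p n : ℤ_[p][X]), q %ₘ omegaPoly p n,
    degree_modByMonic_lt _ (omegaPoly_monic p n).1, ?_⟩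
  have h2 := congrArg (fun r : ℤ_[p][X] => (r : PowerSeries ℤ_[p]))
    (modByMonic_add_div q (omegaPoly p n))
  simp only [Polynomial.coe_add, Polynomial.coe_mul] at h2
  rw [mul_add, add_assoc, add_comm (_ * _) (q %ₘ omegaPoly p n : PowerSeries ℤ_[p]), h2, ← hh,
    sub_add_cancel]

/-- The quotient of two consecutive polynomials is a geometric sum with constant term `p`, a
nonunit. With Krull's intersection theorem this makes the common multiples of infinitely many of
them vanish. -/
theorem omegaPoly_mem_pow (n : ℕ) : (omegaPoly p n : PowerSeries ℤ_[p]) ∈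
    IsLocalRing.maximalIdeal (PowerSeries ℤ_[p]) ^ n := by
  induction n with
  | zero => simp
  | succ n ih =>
    have h1 : (omegaPoly p (n + 1) : PowerSeries ℤ_[p]) =
        (∑ i ∈ Finset.range p, ((PowerSeries.X + 1) ^ p ^ n) ^ i) *
          (omegaPoly p n : PowerSeries ℤ_[p]) := by
      rw [coe_omegaPoly, coe_omegaPoly, geom_sum_mul, ← pow_mul, pow_succ]
    rw [h1, pow_succ']
    refine Ideal.mul_mem_mul ?_ ih
    rw [IsLocalRing.mem_maximalIdeal, mem_nonunits_iff, PowerSeries.isUnit_iff_constantCoeff]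
    simpa [map_sum] using (PadicInt.prime_p (p := p)).not_isUnit

theorem eq_zero_of_forall_omegaPoly_dvd {F : PowerSeries ℤ_[p]}
    (hF : ∀ n, ∃ m, n ≤ m ∧ (omegaPoly p m : PowerSeries ℤ_[p]) ∣ F) : F = 0 := by
  have h := Ideal.iInf_pow_eq_bot_of_isLocalRing (IsLocalRing.maximalIdeal (PowerSeries ℤ_[p]))
    (IsLocalRing.maximalIdeal.isMaximal _).ne_top
  rw [← Ideal.mem_bot, ← h, Ideal.mem_iInf]
  intro n
  obtain ⟨m, hm, g, rfl⟩ := hF n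
  exact Ideal.mul_mem_right _ _ (Ideal.pow_le_pow_right hm (omegaPoly_mem_pow p m))

end Omega

/-! ### Power series evaluated in a finite level `ℤ_p[Q]`. -/

section Level

variable {p : ℕ} [Fact p.Prime] {Q : Type*} [Group Q] {z : Q} {n : ℕ}

theorem aeval_single_sub_one_omegaPoly (hz : z ^ p ^ n = 1) :
    aeval (MonoidAlgebra.single z (1 : ℤ_[p]) - 1) (omegaPoly p n) = 0 := by
  simp [omegaPoly, MonoidAlgebra.single_pow, hz, MonoidAlgebra.one_def]

/-- The homomorphism `ℤ_p[[X]] → ℤ_p[Q]`, `1 + X ↦ z`, for an element `z` of `p`-power order. -/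
def evalLevel (hz : z ^ p ^ n = 1) : PowerSeries ℤ_[p] →ₐ[ℤ_[p]] MonoidAlgebra ℤ_[p] Q :=
  ((Ideal.Quotient.liftₐ (Ideal.span {omegaPoly p n})
    (aeval (MonoidAlgebra.single z (1 : ℤ_[p]) - 1)) (fun a ha => by
      obtain ⟨b, rfl⟩ := Ideal.mem_span_singleton.mp ha
      rw [map_mul, aeval_single_sub_one_omegaPoly hz, zero_mul])).comp
    (omegaPoly_isDistinguishedAt p n).algEquivQuotient.symm.toAlgHom).comp
    (Ideal.Quotient.mkₐ ℤ_[p] _)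

theorem evalLevel_coe (hz : z ^ p ^ n = 1) (q : ℤ_[p][X]) :
    evalLevel hz (q : PowerSeries ℤ_[p]) = aeval (MonoidAlgebra.single z (1 : ℤ_[p]) - 1) q := by
  have h : (omegaPoly_isDistinguishedAt p n).algEquivQuotient.symm
      (Ideal.Quotient.mk _ (q : PowerSeries ℤ_[p])) = Ideal.Quotient.mk _ q := by
    rw [AlgEquiv.symm_apply_eq]; simp
  rw [evalLevel, AlgHom.comp_apply, AlgHom.comp_apply]
  exact (congrArg _ h).trans rfl

theorem evalLevel_one_add_X (hz : z ^ p ^ n = 1) :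
    evalLevel hz (1 + PowerSeries.X) = MonoidAlgebra.single z (1 : ℤ_[p]) := by
  have := evalLevel_coe hz (1 + X)
  simpa using this

/-- No continuity is required: by division with remainder, the image of `F` is that of a polynomial,
since `omegaPoly p n` maps to `0`. -/
theorem algHom_eq_evalLevel (hz : z ^ p ^ n = 1)
    (f : PowerSeries ℤ_[p] →ₐ[ℤ_[p]] MonoidAlgebra ℤ_[p] Q)
    (hf : f (1 + PowerSeries.X) = MonoidAlgebra.single z (1 : ℤ_[p])) (F : PowerSeries ℤ_[p]) :
    f F = evalLevel hz F := by
  have key (f : PowerSeries ℤ_[p] →ₐ[ℤ_[p]] MonoidAlgebra ℤ_[p] Q)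
      (hf : f (1 + PowerSeries.X) = MonoidAlgebra.single z (1 : ℤ_[p])) (q : ℤ_[p][X]) :
      f q = aeval (MonoidAlgebra.single z (1 : ℤ_[p]) - 1) q := by
    have h1 : f PowerSeries.X = MonoidAlgebra.single z (1 : ℤ_[p]) - 1 := by
      rw [← hf, map_add, map_one, add_sub_cancel_left]
    rw [← h1, ← Polynomial.coe_X]
    have := aeval_algHom_apply (f.comp (Polynomial.coeToPowerSeries.algHom ℤ_[p])) X q
    rw [aeval_X_left_apply] at this
    simpa [Algebra.algebraMap_self, Polynomial.map_id] using this.symm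
  obtain ⟨h, r, -, rfl⟩ := exists_eq_omegaPoly_mul_add p n F
  simp only [map_add, map_mul, key f hf, key _ (evalLevel_one_add_X hz),
    aeval_single_sub_one_omegaPoly hz, zero_mul]

theorem evalLevel_surjective (hz : z ^ p ^ n = 1) (hgen : ∀ x : Q, ∃ i : ℕ, z ^ i = x) :
    Function.Surjective (evalLevel hz) := by
  intro y
  induction y using MonoidAlgebra.induction_on with
  | of x =>
    obtain ⟨i, rfl⟩ := hgen x
    exact ⟨(1 + PowerSeries.X) ^ i, by
      rw [map_pow, evalLevel_one_add_X, MonoidAlgebra.of_apply, MonoidAlgebra.single_pow, one_pow]⟩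
  | add a b ha hb =>
    obtain ⟨a, rfl⟩ := ha
    obtain ⟨b, rfl⟩ := hb
    exact ⟨a + b, map_add _ _ _⟩
  | smul r a ha =>
    obtain ⟨a, rfl⟩ := ha
    exact ⟨r • a, map_smul _ _ _⟩

/-- The remainder of `F` has degree below `p ^ n`, and the powers `z ^ i` with `i < p ^ n` are
distinct, hence linearly independent. -/
theorem omegaPoly_dvd_of_evalLevel_eq_zero (hz : z ^ p ^ n = 1) (hord : orderOf z = p ^ n)
    {F : PowerSeries ℤ_[p]} (hF : evalLevel hz F = 0) :
    (omegaPoly p n : PowerSeries ℤ_[p]) ∣ F := by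
  obtain ⟨h, r, hr, rfl⟩ := exists_eq_omegaPoly_mul_add p n F
  rw [map_add, map_mul, evalLevel_coe, evalLevel_coe, aeval_single_sub_one_omegaPoly hz, zero_mul,
    zero_add] at hF
  have h1 : aeval (MonoidAlgebra.single z (1 : ℤ_[p])) (r.comp (X - C 1)) = 0 := by
    rw [aeval_comp]; simpa using hF
  have hdeg : (r.comp (X - C 1)).natDegree < p ^ n ∨ r = 0 := by
    by_cases hr0 : r = 0
    · exact .inr hr0
    · refine .inl ?_
      rw [natDegree_comp, natDegree_X_sub_C, mul_one, ← (omegaPoly_monic p n).2]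
      exact natDegree_lt_natDegree hr0 hr
  have hr0 : r = 0 := by
    rcases hdeg with hdeg | h
    swap
    · exact h
    have h2 : r.comp (X - C 1) = 0 := by
      ext i
      by_cases hi : i < p ^ n
      · have h3 := congrArg (fun y => y.coeff (z ^ i)) h1
        simp only [aeval_eq_sum_range' hdeg, MonoidAlgebra.single_pow, one_pow,
          MonoidAlgebra.coeff_sum, MonoidAlgebra.coeff_smul, Finsupp.coe_finsetSum,
          Finset.sum_apply, Finsupp.smul_apply, MonoidAlgebra.coeff_single] at h3
        rw [Finset.sum_eq_single i] at h3
        · simpa using h3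
        · intro j hj hji
          rw [Finsupp.single_eq_of_ne, smul_zero]
          intro hij
          refine hji (pow_injOn_Iio_orderOf ?_ ?_ hij.symm)
          · rw [hord]; exact Finset.mem_range.mp hj
          · rw [hord]; exact hi
        · intro h; exact absurd (Finset.mem_range.mpr hi) h
      · rw [coeff_eq_zero_of_natDegree_lt (hdeg.trans_le (not_lt.mp hi)), coeff_zero]
    have h3 := congrArg (fun q => q.comp (X + C 1)) h2
    simpa [comp_assoc] using h3
  rw [hr0, Polynomial.coe_zero, add_zero]
  exact dvd_mul_right _ _

open scoped PowerSeries.WithPiTopology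

/-- A nonempty fibre is a translate of a principal ideal, the continuous image of the compact space
`ℤ_p[[X]]`. -/
theorem isClosed_evalLevel_fiber (hz : z ^ p ^ n = 1) (hord : orderOf z = p ^ n)
    (y : MonoidAlgebra ℤ_[p] Q) : IsClosed {F | evalLevel hz F = y} := by
  rcases Set.eq_empty_or_nonempty {F | evalLevel hz F = y} with h | ⟨F₀, hF₀⟩
  · rw [h]; exact isClosed_empty
  have : CompactSpace (PowerSeries ℤ_[p]) :=
    inferInstanceAs (CompactSpace ((Unit →₀ ℕ) → ℤ_[p]))
  have h1 : {F | evalLevel hz F = y} =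
      (fun h => F₀ + (omegaPoly p n : PowerSeries ℤ_[p]) * h) '' Set.univ := by
    ext F
    simp only [Set.mem_ofPred_eq, Set.image_univ, Set.mem_range] at hF₀ ⊢
    constructor
    · intro hF
      obtain ⟨h, hh⟩ := omegaPoly_dvd_of_evalLevel_eq_zero hz hord (F := F - F₀)
        (by rw [map_sub, hF, hF₀, sub_self])
      exact ⟨h, by rw [← hh, add_sub_cancel]⟩
    · rintro ⟨h, rfl⟩
      rw [map_add, hF₀, map_mul, evalLevel_coe, aeval_single_sub_one_omegaPoly hz, zero_mul,
        add_zero]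
  rw [h1]
  exact (isCompact_univ.image (by fun_prop)).isClosed

end Level

/-! ### The isomorphism of `ℤ_p[[D]]` with `ℤ_p[[X]]` for `D ≅ ℤ_p`. -/

section Limit

open scoped PowerSeries.WithPiTopology

variable {p : ℕ} [Fact p.Prime] {D : Type*} [Group D] [TopologicalSpace D]
  (e : D ≃ₜ* Multiplicative ℤ_[p])

/-- The element of `D ≃ ℤ_p` with a given coordinate. -/
def ofPadic (x : ℤ_[p]) : D := e.symm (Multiplicative.ofAdd x)

theorem ofPadic_add (x y : ℤ_[p]) : ofPadic e (x + y) = ofPadic e x * ofPadic e y := by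
  simp [ofPadic]

theorem ofPadic_natCast (n : ℕ) : ofPadic e n = ofPadic e 1 ^ n := by
  rw [ofPadic, ofPadic, ← map_pow, ← ofAdd_nsmul, nsmul_one]

theorem ofPadic_surjective : Function.Surjective (ofPadic e) := fun d =>
  ⟨(e d).toAdd, by simp [ofPadic]⟩

theorem exists_ofPadic_mem (U : OpenNormalSubgroup D) :
    ∃ n, ∀ x ∈ Ideal.span {(p : ℤ_[p]) ^ n}, ofPadic e x ∈ U.toSubgroup := by
  have hcont : Continuous (ofPadic e) := e.symm.continuous_toFun.comp continuous_ofAdd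
  have hopen : IsOpen (ofPadic e ⁻¹' (U.toSubgroup : Set D)) := U.isOpen'.preimage hcont
  have h0 : (0 : ℤ_[p]) ∈ ofPadic e ⁻¹' (U.toSubgroup : Set D) := by
    simp [ofPadic]
  obtain ⟨ε, hε, hball⟩ := Metric.isOpen_iff.mp hopen 0 h0
  obtain ⟨n, hn⟩ := PadicInt.exists_pow_neg_lt p hε
  refine ⟨n, fun x hx => hball ?_⟩
  rw [mem_ball_zero_iff]
  exact ((PadicInt.norm_le_pow_iff_mem_span_pow x n).mpr hx).trans_lt hn

theorem exists_orderOf_ofPadic_one (U : OpenNormalSubgroup D) :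
    ∃ n, orderOf ((ofPadic e 1 : D) : D ⧸ U.toSubgroup) = p ^ n := by
  obtain ⟨n, hn⟩ := exists_ofPadic_mem e U
  have h : ((ofPadic e 1 : D) : D ⧸ U.toSubgroup) ^ p ^ n = 1 := by
    rw [← QuotientGroup.mk_pow, QuotientGroup.eq_one_iff, ← ofPadic_natCast]
    exact hn _ (by simp)
  obtain ⟨m, -, hm⟩ := (Nat.dvd_prime_pow Fact.out).mp (orderOf_dvd_of_pow_eq_one h)
  exact ⟨m, hm⟩

theorem exists_pow_ofPadic_one_eq (U : OpenNormalSubgroup D) (x : D ⧸ U.toSubgroup) :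
    ∃ i : ℕ, ((ofPadic e 1 : D) : D ⧸ U.toSubgroup) ^ i = x := by
  obtain ⟨n, hn⟩ := exists_ofPadic_mem e U
  obtain ⟨d, rfl⟩ := QuotientGroup.mk_surjective x
  obtain ⟨y, rfl⟩ := ofPadic_surjective e d
  refine ⟨y.appr n, ?_⟩
  rw [← QuotientGroup.mk_pow, QuotientGroup.eq, ← ofPadic_natCast]
  have h1 := hn _ (PadicInt.appr_spec n y)
  have h2 : ofPadic e y = ofPadic e (y.appr n : ℕ) * ofPadic e (y - (y.appr n : ℕ)) := by
    rw [← ofPadic_add, add_sub_cancel]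
  rw [h2, inv_mul_cancel_left]
  exact h1

theorem exists_openNormalSubgroup_orderOf_ge (n : ℕ) : ∃ (U : OpenNormalSubgroup D) (m : ℕ),
    n ≤ m ∧ orderOf ((ofPadic e 1 : D) : D ⧸ U.toSubgroup) = p ^ m := by
  let f : D →* Multiplicative (ZMod (p ^ n)) :=
    (AddMonoidHom.toMultiplicative (PadicInt.toZModPow (p := p) n).toAddMonoidHom).comp
      e.toMulEquiv.toMonoidHom
  have hf (x : ℤ_[p]) : ofPadic e x ∈ f.ker ↔ PadicInt.toZModPow n x = 0 := by
    have h1 : f (ofPadic e x) = Multiplicative.ofAdd (PadicInt.toZModPow n x) := by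
      change Multiplicative.ofAdd (PadicInt.toZModPow n (e (e.symm (Multiplicative.ofAdd x))).toAdd)
        = _
      rw [ContinuousMulEquiv.apply_symm_apply, toAdd_ofAdd]
    rw [MonoidHom.mem_ker, h1, ofAdd_eq_one]
  have hopen : IsOpen (f.ker : Set D) := by
    have h1 : (f.ker : Set D) = (fun d => (e d).toAdd) ⁻¹'
        Metric.closedBall (0 : ℤ_[p]) ((p : ℝ) ^ (-(n : ℤ))) := by
      ext d
      obtain ⟨x, rfl⟩ := ofPadic_surjective e d
      rw [SetLike.mem_coe, hf, ← RingHom.mem_ker, PadicInt.ker_toZModPow,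
        ← PadicInt.norm_le_pow_iff_mem_span_pow]
      simp [ofPadic]
    rw [h1]
    refine (IsUltrametricDist.isOpen_closedBall _ (by
      have := (Fact.out : p.Prime).pos
      positivity)).preimage ?_
    exact continuous_toAdd.comp e.continuous_toFun
  let U : OpenNormalSubgroup D := { toSubgroup := f.ker, isOpen' := hopen }
  obtain ⟨m, hm⟩ := exists_orderOf_ofPadic_one e U
  refine ⟨U, m, ?_, hm⟩
  have h1 : ((ofPadic e 1 : D) : D ⧸ U.toSubgroup) ^ p ^ m = 1 := by rw [← hm, pow_orderOf_eq_one]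
  rw [← QuotientGroup.mk_pow, QuotientGroup.eq_one_iff, ← ofPadic_natCast] at h1
  have h2 := (hf _).mp h1
  rw [map_natCast, ZMod.natCast_eq_zero_iff] at h2
  exact (Nat.pow_dvd_pow_iff_le_right (Fact.out : p.Prime).one_lt).mp h2

/-- The Iwasawa algebra of a group isomorphic to `ℤ_p` is the power series ring `ℤ_p[[X]]`, a
topological generator corresponding to `1 + X`. -/
theorem exists_algEquiv_powerSeries : ∃ Θ : IwasawaAlgebra p D ≃ₐ[ℤ_[p]] PowerSeries ℤ_[p],
    Θ (of p (ofPadic e 1)) = 1 + PowerSeries.X := by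
  choose n hn using exists_orderOf_ofPadic_one e
  have hz (U : OpenNormalSubgroup D) : ((ofPadic e 1 : D) : D ⧸ U.toSubgroup) ^ p ^ n U = 1 := by
    rw [← hn U, pow_orderOf_eq_one]
  have hcompat (F : PowerSeries ℤ_[p]) (U V : OpenNormalSubgroup D)
      (h : U.toSubgroup ≤ V.toSubgroup) :
      transition p D h (evalLevel (hz U) F) = evalLevel (hz V) F := by
    refine algHom_eq_evalLevel (hz V) ((transition p D h).comp (evalLevel (hz U))) ?_ F
    rw [AlgHom.comp_apply, evalLevel_one_add_X]
    simp only [transition, MonoidAlgebra.mapDomainAlgHom_apply, MonoidAlgebra.mapDomain_single]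
    rfl
  let Ψ : PowerSeries ℤ_[p] →ₐ[ℤ_[p]] IwasawaAlgebra p D :=
    (AlgHom.pi fun U => evalLevel (hz U)).codRestrict (iwasawaSubalgebra p D) hcompat
  have hΨ (F : PowerSeries ℤ_[p]) (U : OpenNormalSubgroup D) : (Ψ F).1 U = evalLevel (hz U) F := rfl
  have hinj : Function.Injective Ψ := by
    rw [injective_iff_map_eq_zero]
    intro F hF
    refine eq_zero_of_forall_omegaPoly_dvd p fun i => ?_
    obtain ⟨U, m, him, hm⟩ := exists_openNormalSubgroup_orderOf_ge e i
    have hmn : m = n U := Nat.pow_right_injective (Fact.out : p.Prime).two_le (hm.symm.trans (hn U))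
    subst hmn
    exact ⟨_, him, omegaPoly_dvd_of_evalLevel_eq_zero (hz U) (hn U) (by rw [← hΨ, hF]; rfl)⟩
  have hsurj : Function.Surjective Ψ := by
    intro x
    have : CompactSpace (PowerSeries ℤ_[p]) :=
      inferInstanceAs (CompactSpace ((Unit →₀ ℕ) → ℤ_[p]))
    have hclosed (U : OpenNormalSubgroup D) := isClosed_evalLevel_fiber (hz U) (hn U) (x.1 U)
    have hne : Nonempty (OpenNormalSubgroup D) :=
      ⟨(exists_openNormalSubgroup_orderOf_ge e 0).choose⟩
    -- Each level has a nonempty closed set of lifts of `x`; compactness of `ℤ_p[[X]]` yields a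
    -- common one.
    obtain ⟨F, hF⟩ := IsCompact.nonempty_iInter_of_directed_nonempty_isCompact_isClosed
      (fun U : OpenNormalSubgroup D => {F | evalLevel (hz U) F = x.1 U}) (by
        intro U V
        refine ⟨U ⊓ V, fun F hF => ?_, fun F hF => ?_⟩
        · have h : (U ⊓ V).toSubgroup ≤ U.toSubgroup := fun _ h => h.1
          rw [Set.mem_ofPred_eq] at hF ⊢
          rw [← hcompat F _ _ h, hF, x.2]
        · have h : (U ⊓ V).toSubgroup ≤ V.toSubgroup := fun _ h => h.2
          rw [Set.mem_ofPred_eq] at hF ⊢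
          rw [← hcompat F _ _ h, hF, x.2])
      (fun U => evalLevel_surjective (hz U) (exists_pow_ofPadic_one_eq e U) (x.1 U))
      (fun U => (hclosed U).isCompact) hclosed
    refine ⟨F, Subtype.ext (funext fun U => ?_)⟩
    exact Set.mem_iInter.mp hF U
  refine ⟨(AlgEquiv.ofBijective Ψ ⟨hinj, hsurj⟩).symm, ?_⟩
  rw [AlgEquiv.symm_apply_eq]
  refine Subtype.ext (funext fun U => ?_)
  exact (evalLevel_one_add_X (hz U)).symm

end Limit

end

/-! ### Restricting coefficients to a subgroup, at finite level. -/

section Comap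

variable {k A B : Type*} [CommRing k] [Group A] [Group B] {j : A →* B}
  (hj : Function.Injective j)

/-- Restriction of coefficients along an injective homomorphism of groups. -/
def comapCoeff : MonoidAlgebra k B →ₗ[k] MonoidAlgebra k A where
  toFun x := MonoidAlgebra.ofCoeff (x.coeff.comapDomain j hj.injOn)
  map_add' x y := by ext; simp
  map_smul' r x := by ext; simp

theorem coeff_comapCoeff (x : MonoidAlgebra k B) (a : A) :
    (comapCoeff hj x).coeff a = x.coeff (j a) := rfl

theorem comapCoeff_single (a : A) (r : k) :
    comapCoeff hj (MonoidAlgebra.single (j a) r) = MonoidAlgebra.single a r := by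
  classical
  ext b
  simp [coeff_comapCoeff, Finsupp.single_apply, hj.eq_iff]

theorem comapCoeff_single_of_notMem {b : B} (hb : b ∉ j.range) (r : k) :
    comapCoeff hj (MonoidAlgebra.single b r) = 0 := by
  classical
  ext a
  have : b ≠ j a := fun h => hb ⟨a, h.symm⟩
  simp [coeff_comapCoeff, this]

theorem comapCoeff_mapDomain_mul (y : MonoidAlgebra k A) (x : MonoidAlgebra k B) :
    comapCoeff hj (MonoidAlgebra.mapDomainAlgHom k k j y * x) = y * comapCoeff hj x := by
  induction y using MonoidAlgebra.induction_on with
  | add a b ha hb => rw [map_add, add_mul, map_add, ha, hb, add_mul]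
  | smul r a ha => rw [map_smul, smul_mul_assoc, map_smul, ha, smul_mul_assoc]
  | of a =>
    induction x using MonoidAlgebra.induction_on with
    | add b c hb hc => rw [mul_add, map_add, hb, hc, map_add, mul_add]
    | smul r b hb => rw [mul_smul_comm, map_smul, hb, map_smul, mul_smul_comm]
    | of b =>
      simp only [MonoidAlgebra.of_apply, MonoidAlgebra.mapDomainAlgHom_apply,
        MonoidAlgebra.mapDomain_single, MonoidAlgebra.single_mul_single, one_mul]
      by_cases hb : b ∈ j.range
      · obtain ⟨c, rfl⟩ := hb
        rw [← map_mul, comapCoeff_single, comapCoeff_single, MonoidAlgebra.single_mul_single,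
          one_mul]
      · rw [comapCoeff_single_of_notMem hj hb, mul_zero, comapCoeff_single_of_notMem]
        rwa [Subgroup.mul_mem_cancel_left _ (MonoidHom.mem_range.mpr ⟨a, rfl⟩)]

theorem mapDomain_comapCoeff {A' B' : Type*} [Group A'] [Group B'] {j' : A' →* B'}
    (hj' : Function.Injective j') {a : A →* A'} {b : B →* B'} (hab : ∀ x, j' (a x) = b (j x))
    (hcart : ∀ x, b x ∈ j'.range → x ∈ j.range) (y : MonoidAlgebra k B) :
    MonoidAlgebra.mapDomainAlgHom k k a (comapCoeff hj y) =
      comapCoeff hj' (MonoidAlgebra.mapDomainAlgHom k k b y) := by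
  induction y using MonoidAlgebra.induction_on with
  | add x y hx hy => simp only [map_add, hx, hy]
  | smul r x hx => simp only [map_smul, hx]
  | of x =>
    simp only [MonoidAlgebra.of_apply, MonoidAlgebra.mapDomainAlgHom_apply,
        MonoidAlgebra.mapDomain_single]
    by_cases hx : x ∈ j.range
    · obtain ⟨c, rfl⟩ := hx
      rw [← hab, comapCoeff_single, comapCoeff_single, MonoidAlgebra.mapDomain_single]
    · rw [comapCoeff_single_of_notMem hj hx, comapCoeff_single_of_notMem hj'
        (fun h => hx (hcart x h)), MonoidAlgebra.mapDomain_zero]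

/-- For a group element `b` only the summand of the coset containing `b` survives, and it returns
`b`. -/
theorem sum_mapDomain_comapCoeff {ι : Type*} [Fintype ι] (g : ι → B)
    (hg : ∀ b, ∃ w₀, ∀ w, b * (g w)⁻¹ ∈ j.range ↔ w = w₀) (x : MonoidAlgebra k B) :
    ∑ w, MonoidAlgebra.mapDomainAlgHom k k j
      (comapCoeff hj (x * MonoidAlgebra.single (g w)⁻¹ 1)) * MonoidAlgebra.single (g w) 1 = x := by
  induction x using MonoidAlgebra.induction_on with
  | add x y hx hy =>
    simp only [add_mul, map_add, Finset.sum_add_distrib, hx, hy]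
  | smul r x hx => simp only [smul_mul_assoc, map_smul, ← Finset.smul_sum, hx]
  | of b =>
    obtain ⟨w₀, hw₀⟩ := hg b
    simp only [MonoidAlgebra.of_apply, MonoidAlgebra.single_mul_single, one_mul]
    rw [Finset.sum_eq_single w₀]
    · obtain ⟨a, ha⟩ := (hw₀ w₀).mpr rfl
      rw [← ha, comapCoeff_single, MonoidAlgebra.mapDomainAlgHom_apply,
        MonoidAlgebra.mapDomain_single, ha, MonoidAlgebra.single_mul_single, one_mul,
        inv_mul_cancel_right]
    · intro w _ hw
      rw [comapCoeff_single_of_notMem hj (fun h => hw ((hw₀ w).mp h)), map_zero, zero_mul]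
    · simp

end Comap

section Unit

variable (p : ℕ) [Fact p.Prime] (G : Type*) [Group G] [TopologicalSpace G]

/-- The canonical homomorphism from a group to its Iwasawa algebra. -/
def ofHom : G →* IwasawaAlgebra p G where
  toFun := of p
  map_one' := by ext1; funext U; simp [of, MonoidAlgebra.one_def]
  map_mul' x y := by ext1; funext U; simp [of, MonoidAlgebra.single_mul_single]

variable {G}

theorem ofHom_apply (g : G) : ofHom p G g = of p g := rfl

end Unit

/-! ### The Iwasawa algebra as a free module over that of an open central subgroup. -/

section CentralSubgroup

variable {p : ℕ} [Fact p.Prime] {G : Type*} [Group G] [TopologicalSpace G]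
  {C : Subgroup (Subgroup.center G)}

theorem centralInclusion_injective : Function.Injective (centralInclusion C) :=
  Subtype.val_injective.comp Subtype.val_injective

theorem isOpenEmbedding_centralInclusion
    (hC : IsOpen ((C.map (Subgroup.center G).subtype : Subgroup G) : Set G)) :
    Topology.IsOpenEmbedding (centralInclusion C) where
  toIsInducing := Topology.IsInducing.subtypeVal.comp Topology.IsInducing.subtypeVal
  injective := centralInclusion_injective
  isOpen_range := by
    have h : Set.range (centralInclusion C) =
        ((C.map (Subgroup.center G).subtype : Subgroup G) : Set G) := by
      ext x
      constructor
      · rintro ⟨c, rfl⟩; exact ⟨c.1, c.2, rfl⟩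
      · rintro ⟨c, hc, rfl⟩; exact ⟨⟨c, hc⟩, rfl⟩
    rw [h]; exact hC

variable (hC : IsOpen ((C.map (Subgroup.center G).subtype : Subgroup G) : Set G))

/-- An open subgroup of an open central subgroup, as an open normal subgroup of the group. -/
def extend (U : OpenNormalSubgroup C) : OpenNormalSubgroup G where
  toSubgroup := U.toSubgroup.map (centralInclusion C).toMonoidHom
  isOpen' := (isOpenEmbedding_centralInclusion hC).isOpenMap _ U.isOpen'
  isNormal' := ⟨by
    rintro _ ⟨c, hc, rfl⟩ g
    refine ⟨c, hc, ?_⟩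
    change ((c : Subgroup.center G) : G) = g * ((c : Subgroup.center G) : G) * g⁻¹
    rw [Subgroup.mem_center_iff.mp c.1.2 g, mul_inv_cancel_right]⟩

theorem mem_extend {U : OpenNormalSubgroup C} {g : G} :
    g ∈ (extend hC U).toSubgroup ↔ ∃ c ∈ U.toSubgroup, centralInclusion C c = g := Iff.rfl

theorem extend_mono {U V : OpenNormalSubgroup C} (h : U.toSubgroup ≤ V.toSubgroup) :
    (extend hC U).toSubgroup ≤ (extend hC V).toSubgroup := Subgroup.map_mono h

/-- The homomorphism `C / U → G / U`, for `U` an open subgroup of the open central subgroup `C`. -/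
def quotientInclusion (U : OpenNormalSubgroup C) :
    C ⧸ U.toSubgroup →* G ⧸ (extend hC U).toSubgroup :=
  QuotientGroup.map _ _ (centralInclusion C).toMonoidHom (Subgroup.le_comap_map _ _)

theorem quotientInclusion_mk (U : OpenNormalSubgroup C) (c : C) :
    quotientInclusion hC U c = (centralInclusion C c : G) := rfl

theorem quotientInclusion_injective (U : OpenNormalSubgroup C) :
    Function.Injective (quotientInclusion hC U) := by
  rw [injective_iff_map_eq_one]
  intro x hx
  induction x using QuotientGroup.induction_on with | _ c
  rw [quotientInclusion_mk, QuotientGroup.eq_one_iff, mem_extend] at hx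
  obtain ⟨d, hd, hdc⟩ := hx
  rw [QuotientGroup.eq_one_iff, ← centralInclusion_injective hdc]
  exact hd

theorem mk_mem_range_quotientInclusion {U : OpenNormalSubgroup C} {g : G} :
    (g : G ⧸ (extend hC U).toSubgroup) ∈ (quotientInclusion hC U).range ↔
      g ∈ C.map (Subgroup.center G).subtype := by
  constructor
  · rintro ⟨x, hx⟩
    induction x using QuotientGroup.induction_on with | _ c
    rw [quotientInclusion_mk, QuotientGroup.eq, mem_extend] at hx
    obtain ⟨d, -, hd⟩ := hx
    refine ⟨(c * d : C), (c * d).2, ?_⟩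
    change centralInclusion C (c * d) = g
    rw [map_mul, hd, mul_inv_cancel_left]
  · rintro ⟨c, hc, rfl⟩
    exact ⟨((⟨c, hc⟩ : C) : C ⧸ U.toSubgroup), rfl⟩

theorem map_centralInclusion_extend (r : IwasawaAlgebra p C) (U : OpenNormalSubgroup C) :
    (map p (centralInclusion C) r).1 (extend hC U) =
      MonoidAlgebra.mapDomainAlgHom ℤ_[p] ℤ_[p] (quotientInclusion hC U) (r.1 U) := by
  have h : U.toSubgroup ≤ (preimage (centralInclusion C) (extend hC U)).toSubgroup :=
    Subgroup.le_comap_map _ _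
  change levelMap p (centralInclusion C) (extend hC U)
    (r.1 (preimage (centralInclusion C) (extend hC U))) = _
  rw [← r.2 _ _ h]
  generalize r.1 U = y
  induction y using MonoidAlgebra.induction_on with
  | add a b ha hb => simp only [map_add, ha, hb]
  | smul r a ha => simp only [map_smul, ha]
  | of a =>
    induction a using QuotientGroup.induction_on
    simp only [transition, levelMap, MonoidAlgebra.of_apply, MonoidAlgebra.mapDomainAlgHom_apply,
      MonoidAlgebra.mapDomain_single]
    rfl

/-- The levels coming from open subgroups of `C` are cofinal: an open normal `V` contains `V ∩ C`,
which is open in `G`. -/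
theorem ext_extend {x y : IwasawaAlgebra p G} (h : ∀ U, x.1 (extend hC U) = y.1 (extend hC U)) :
    x = y := by
  refine Subtype.ext (funext fun V => ?_)
  have hV : (extend hC (preimage (centralInclusion C) V)).toSubgroup ≤ V.toSubgroup :=
    Subgroup.map_comap_le _ _
  rw [← x.2 _ _ hV, h, y.2]

/-- The projection of `ℤ_p[[G]]` onto `ℤ_p[[C]]`, for `C` an open central subgroup of `G`. -/
def coeffProj : IwasawaAlgebra p G →+ IwasawaAlgebra p C where
  toFun x := ⟨fun U => comapCoeff (quotientInclusion_injective hC U) (x.1 (extend hC U)), by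
    intro U V h
    change transition p C h (comapCoeff _ (x.1 (extend hC U))) = comapCoeff _ (x.1 (extend hC V))
    rw [← x.2 _ _ (extend_mono hC h)]
    refine mapDomain_comapCoeff _ _ (fun c => ?_) (fun g hg => ?_) _
    · induction c using QuotientGroup.induction_on
      rfl
    · induction g using QuotientGroup.induction_on with | _ g
      exact (mk_mem_range_quotientInclusion hC).mpr ((mk_mem_range_quotientInclusion hC).mp hg)⟩
  map_add' x y := by
    refine Subtype.ext (funext fun U => ?_)
    exact map_add (comapCoeff (quotientInclusion_injective hC U)) _ _
  map_zero' := by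
    refine Subtype.ext (funext fun U => ?_)
    exact map_zero (comapCoeff (quotientInclusion_injective hC U))

theorem coeffProj_apply (x : IwasawaAlgebra p G) (U : OpenNormalSubgroup C) :
    (coeffProj hC x).1 U =
      comapCoeff (quotientInclusion_injective hC U) (x.1 (extend hC U)) := rfl

theorem coeffProj_smul (r : IwasawaAlgebra p C) (x : IwasawaAlgebra p G) :
    coeffProj hC (r • x) = r * coeffProj hC x := by
  refine Subtype.ext (funext fun U => ?_)
  change comapCoeff _ ((map p (centralInclusion C) r).1 (extend hC U) * x.1 (extend hC U)) =
    r.1 U * comapCoeff _ (x.1 (extend hC U))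
  rw [map_centralInclusion_extend, comapCoeff_mapDomain_mul]

theorem coeffProj_of_notMem {g : G} (hg : g ∉ C.map (Subgroup.center G).subtype) :
    coeffProj hC (ofHom p G g) = 0 := by
  refine Subtype.ext (funext fun U => ?_)
  rw [coeffProj_apply]
  exact comapCoeff_single_of_notMem _ (fun h => hg ((mk_mem_range_quotientInclusion hC).mp h)) 1

theorem coeffProj_one : coeffProj hC (1 : IwasawaAlgebra p G) = 1 := by
  refine Subtype.ext (funext fun U => ?_)
  rw [coeffProj_apply]
  have := comapCoeff_single (k := ℤ_[p]) (quotientInclusion_injective hC U) 1 1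
  rwa [map_one] at this

omit [TopologicalSpace G] in
theorem out_inv_mul_mem_iff {g : G} {w : G ⧸ C.map (Subgroup.center G).subtype} :
    g * w.out⁻¹ ∈ C.map (Subgroup.center G).subtype ↔ w = g := by
  have h : g * w.out⁻¹ ∈ C.map (Subgroup.center G).subtype ↔
      w.out⁻¹ * g ∈ C.map (Subgroup.center G).subtype := by
    have hn : (C.map (Subgroup.center G).subtype).Normal := by
      refine ⟨?_⟩
      rintro _ ⟨c, hc, rfl⟩ g
      exact ⟨c, hc, by simp [Subgroup.mem_center_iff.mp c.2 g]⟩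
    exact hn.mem_comm_iff
  rw [h, ← QuotientGroup.eq, QuotientGroup.out_eq']

variable [Fintype (G ⧸ C.map (Subgroup.center G).subtype)]

theorem sum_coeffProj_smul (x : IwasawaAlgebra p G) :
    ∑ w : G ⧸ C.map (Subgroup.center G).subtype,
      coeffProj hC (x * ofHom p G w.out⁻¹) • ofHom p G w.out = x := by
  refine ext_extend hC fun U => ?_
  have h := sum_mapDomain_comapCoeff (k := ℤ_[p]) (quotientInclusion_injective hC U)
    (fun w : G ⧸ C.map (Subgroup.center G).subtype => (w.out : G ⧸ (extend hC U).toSubgroup))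
    (fun b => by
      induction b using QuotientGroup.induction_on with | _ g
      refine ⟨g, fun w => ?_⟩
      rw [← QuotientGroup.mk_inv, ← QuotientGroup.mk_mul, mk_mem_range_quotientInclusion,
        out_inv_mul_mem_iff]) (x.1 (extend hC U))
  refine Eq.trans ?_ h
  rw [AddSubmonoidClass.coe_finsetSum, Finset.sum_apply]
  refine Finset.sum_congr rfl fun w _ => ?_
  change (map p (centralInclusion C) _).1 (extend hC U) * _ = _
  rw [map_centralInclusion_extend, coeffProj_apply]
  rfl

/-- Representatives of the cosets of an open central subgroup `C` of finite index form a basis of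
`ℤ_p[[G]]` over `ℤ_p[[C]]`. -/
def cosetBasis : Module.Basis (G ⧸ C.map (Subgroup.center G).subtype) (IwasawaAlgebra p C)
    (IwasawaAlgebra p G) :=
  .ofEquivFun
    { toFun := fun x w => coeffProj hC (x * ofHom p G w.out⁻¹)
      map_add' := fun x y => by funext w; rw [add_mul, map_add]; rfl
      map_smul' := fun r x => by funext w; rw [smul_mul_assoc, coeffProj_smul]; rfl
      invFun := fun f => ∑ w, f w • ofHom p G w.out
      left_inv := sum_coeffProj_smul hC
      right_inv := fun f => by
        classical
        funext w
        change coeffProj hC ((∑ v, f v • ofHom p G v.out) * ofHom p G w.out⁻¹) = f w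
        rw [Finset.sum_mul, map_sum, Finset.sum_eq_single w]
        · rw [smul_mul_assoc, coeffProj_smul, ← map_mul, mul_inv_cancel, map_one, coeffProj_one,
            mul_one]
        · intro v _ hv
          rw [smul_mul_assoc, coeffProj_smul, ← map_mul, coeffProj_of_notMem, mul_zero]
          rw [out_inv_mul_mem_iff, QuotientGroup.out_eq']
          exact hv.symm
        · simp }

theorem cosetBasis_apply (w : G ⧸ C.map (Subgroup.center G).subtype) :
    cosetBasis (p := p) hC w = ofHom p G w.out := by
  classical
  rw [cosetBasis, Module.Basis.coe_ofEquivFun]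
  change ∑ v, (Pi.single w 1 : _ → IwasawaAlgebra p C) v • ofHom p G v.out = _
  rw [Finset.sum_eq_single w]
  · simp
  · intro v _ hv
    rw [Pi.single_eq_of_ne hv, zero_smul]
  · simp

theorem cosetBasis_repr (x : IwasawaAlgebra p G) (w : G ⧸ C.map (Subgroup.center G).subtype) :
    (cosetBasis hC).repr x w = coeffProj hC (x * ofHom p G w.out⁻¹) := rfl

end CentralSubgroup

/-! ### Reduction modulo `p`. -/

section ModP

open TensorProduct

open PowerSeries in
-- A `p`-th root would be a power series, since `k[[X]]` is integrally closed. The derivative of a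
-- `p`-th power is `0` in characteristic `p`, whereas that of `c(1 + X)` is `c`.
theorem pow_ne_one_add_X {k E : Type*} [Field k] {p : ℕ} [CharP k p] (hp : p ≠ 0) [Field E]
    [Algebra (PowerSeries k) E] [IsFractionRing (PowerSeries k) E] {c : k} (hc : c ≠ 0) (b : E) :
    b ^ p ≠ algebraMap (PowerSeries k) E (C c * (1 + X)) := by
  intro h
  obtain ⟨s, rfl⟩ := IsIntegrallyClosed.exists_algebraMap_eq_of_isIntegral_pow hp.bot_lt
    (h ▸ isIntegral_algebraMap)
  rw [← map_pow] at h
  have h1 := congrArg (derivative k) (IsFractionRing.injective (PowerSeries k) E h)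
  rw [derivative_pow, ← map_natCast (C (R := k)) p, CharP.cast_eq_zero, map_zero,
    zero_mul, zero_mul, Derivation.leibniz, derivative_C, map_add, Derivation.map_one_eq_zero, derivative_X, zero_add, smul_zero, add_zero,
    smul_eq_mul, mul_one] at h1
  exact hc ((map_eq_zero_iff _ C_injective).mp h1.symm)

theorem map_algebraMap_toZMod_eq_zero_iff {p : ℕ} [Fact p.Prime] {k : Type*} [Field k]
    [Algebra (ZMod p) k] (F : PowerSeries ℤ_[p]) :
    PowerSeries.map ((algebraMap (ZMod p) k).comp PadicInt.toZMod) F = 0 ↔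
      (p : PowerSeries ℤ_[p]) ∣ F := by
  have hp : (p : PowerSeries ℤ_[p]) = PowerSeries.C (p : ℤ_[p]) := by simp
  have h (x : ℤ_[p]) : ((algebraMap (ZMod p) k).comp PadicInt.toZMod) x = 0 ↔ (p : ℤ_[p]) ∣ x := by
    rw [RingHom.comp_apply, map_eq_zero, ← RingHom.mem_ker, PadicInt.ker_toZMod,
      PadicInt.maximalIdeal_eq_span_p, Ideal.mem_span_singleton]
  constructor
  · intro hF
    have h1 (i : ℕ) : (p : ℤ_[p]) ∣ PowerSeries.coeff i F := by
      rw [← h, ← PowerSeries.coeff_map, hF, map_zero]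
    choose G hG using h1
    refine ⟨PowerSeries.mk G, PowerSeries.ext fun i => ?_⟩
    rw [hp, PowerSeries.coeff_C_mul, PowerSeries.coeff_mk, hG]
  · rintro ⟨G, rfl⟩
    rw [map_mul, hp, PowerSeries.map_C, (h _).mpr dvd_rfl, map_zero, zero_mul]

/-- Base change along `R → E`, whose kernel is `p R`, turns the hypothesis into `x B x = 0` for `B =
E ⊗ L`. Semiprimeness gives `1 ⊗ x = 0`, and freeness of `L` makes each coordinate of `x` divisible
by `p`. -/
theorem dvd_of_forall_dvd_mul_mul {R L k E G : Type*} [CommRing R] [Ring L] [Algebra R L] [Field k]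
    [IsAlgClosed k] [Field E] [Algebra k E] [Algebra R E] [Group G] {p : ℕ} (hp : p.Prime)
    (hp2 : p ≠ 2) (hker : ∀ r, algebraMap R E r = 0 ↔ (p : R) ∣ r) (φ : G →* L) (N : Subgroup G)
    [N.Normal] [Fintype N] [NeZero (Nat.card N : k)] {ι : Type*} [Fintype ι]
    (b : Module.Basis ι R L) (hb : ∀ i, ∃ g, b i = φ g) {D H : Subgroup G}
    (hDc : D ≤ Subgroup.center G) {δ : G → R} (hD : ∀ d ∈ D, φ d = algebraMap R L (δ d))
    {γ : G} (hγ : γ ∈ D)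
    (hγp : ∀ c : k, c ≠ 0 → ∀ b : E, b ^ p ≠ algebraMap k E c * algebraMap R E (δ γ))
    (hHN : ∀ h ∈ H, h ∉ N → ∀ n ∈ N, ∃ m ∈ N, m * h * m⁻¹ = n * h)
    (hgen : ∀ S : Subgroup G, D ≤ S → ∃ t ∈ S, (∃ n : ℕ, ∃ h ∈ H, t ^ p ^ n = h * γ) ∧
      ∀ s ∈ S, ∃ h ∈ H, ∃ i : ℕ, ∃ d ∈ D, s = h * t ^ i * d)
    {x : L} (hx : ∀ c, (p : L) ∣ x * c * x) (hNx : (∑ n : N, φ n) * x = 0) : (p : L) ∣ x := by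
  have : SMulCommClass R k E := ⟨fun r c y => by
    rw [Algebra.smul_def, Algebra.smul_def, Algebra.smul_def, Algebra.smul_def, mul_left_comm]⟩
  let φ' : G →* E ⊗[R] L :=
    (Algebra.TensorProduct.includeRight : L →ₐ[R] E ⊗[R] L).toMonoidHom.comp φ
  have hφ' (g : G) : φ' g = 1 ⊗ₜ φ g := rfl
  have hspan : Submodule.span E (Set.range φ') = ⊤ := by
    rw [eq_top_iff, ← (b.baseChange E).span_eq, Submodule.span_le]
    rintro _ ⟨i, rfl⟩
    obtain ⟨g, hg⟩ := hb i
    refine Submodule.subset_span ⟨g, ?_⟩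
    rw [Module.Basis.baseChange_apply, hg, hφ']
  have hpE : (p : E) = 0 := by
    rw [← map_natCast (algebraMap R E), hker]
  have hx' (y : E ⊗[R] L) : (1 ⊗ₜ x) * y * (1 ⊗ₜ x) = 0 := by
    induction y using TensorProduct.induction_on with
    | zero => rw [mul_zero, zero_mul]
    | add y z hy hz => rw [mul_add, add_mul, hy, hz, add_zero]
    | tmul a c =>
      obtain ⟨m, hm⟩ := hx c
      rw [Algebra.TensorProduct.tmul_mul_tmul, Algebra.TensorProduct.tmul_mul_tmul, hm, one_mul,
        mul_one, ← nsmul_eq_mul, ← TensorProduct.smul_tmul, nsmul_eq_mul, hpE, zero_mul,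
        TensorProduct.zero_tmul]
  have h0 : (1 : E) ⊗ₜ[R] x = 0 := by
    refine eq_zero_of_forall_mul_mul_eq_zero (k := k) (E := E) φ' N hp hp2 hspan hDc
      (δ := fun d => algebraMap R E (δ d)) (fun d hd => ?_) hγ hγp hHN hgen hx' ?_
    · rw [hφ', hD d hd, Algebra.algebraMap_eq_smul_one, ← TensorProduct.smul_tmul,
        ← Algebra.algebraMap_eq_smul_one]
      rfl
    · simp_rw [hφ']
      rw [← TensorProduct.tmul_sum,
        Algebra.TensorProduct.tmul_mul_tmul, hNx, TensorProduct.tmul_zero]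
  have h1 (i : ι) : (p : R) ∣ b.repr x i := by
    rw [← hker, ← mul_one (algebraMap R E _), ← Algebra.smul_def,
      ← Module.Basis.baseChange_repr_tmul, h0, map_zero, Finsupp.zero_apply]
  choose m hm using h1
  refine ⟨∑ i, m i • b i, ?_⟩
  conv_lhs => rw [← b.sum_repr x]
  simp_rw [Finset.mul_sum, hm, mul_smul, ← nsmul_eq_mul, Nat.cast_smul_eq_nsmul]

theorem dvd_of_forall_dvd_mul_mul_of_powerSeries {R L G : Type*} [CommRing R] [Ring L]
    [Algebra R L] [Group G] {p : ℕ} [Fact p.Prime] (hp2 : p ≠ 2) (Θ : R ≃+* PowerSeries ℤ_[p])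
    (φ : G →* L) (N : Subgroup G) [N.Normal] [Fintype N] (hpN : ¬ p ∣ Nat.card N)
    {ι : Type*} [Fintype ι] (b : Module.Basis ι R L) (hb : ∀ i, ∃ g, b i = φ g)
    {D H : Subgroup G} (hDc : D ≤ Subgroup.center G) {δ : G → R}
    (hD : ∀ d ∈ D, φ d = algebraMap R L (δ d)) {γ : G} (hγ : γ ∈ D)
    (hΘ : Θ (δ γ) = 1 + PowerSeries.X)
    (hHN : ∀ h ∈ H, h ∉ N → ∀ n ∈ N, ∃ m ∈ N, m * h * m⁻¹ = n * h)
    (hgen : ∀ S : Subgroup G, D ≤ S → ∃ t ∈ S, (∃ n : ℕ, ∃ h ∈ H, t ^ p ^ n = h * γ) ∧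
      ∀ s ∈ S, ∃ h ∈ H, ∃ i : ℕ, ∃ d ∈ D, s = h * t ^ i * d)
    {x : L} (hx : ∀ c, (p : L) ∣ x * c * x) (hNx : (∑ n : N, φ n) * x = 0) : (p : L) ∣ x := by
  let k := AlgebraicClosure (ZMod p)
  let E := FractionRing (PowerSeries k)
  let f : R →+* E := (algebraMap (PowerSeries k) E).comp
    ((PowerSeries.map ((algebraMap (ZMod p) k).comp PadicInt.toZMod)).comp Θ.toRingHom)
  let : Algebra R E := f.toAlgebra
  have hf (r : R) : algebraMap R E r = algebraMap (PowerSeries k) E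
      (PowerSeries.map ((algebraMap (ZMod p) k).comp PadicInt.toZMod) (Θ r)) := rfl
  have : CharP k p := charP_of_injective_algebraMap (algebraMap (ZMod p) k).injective p
  have : NeZero (Nat.card N : k) := ⟨by rwa [Ne, CharP.cast_eq_zero_iff k p]⟩
  refine dvd_of_forall_dvd_mul_mul (k := k) (E := E) Fact.out hp2 (fun r => ?_) φ N b hb hDc hD hγ
    (fun c hc b => ?_) hHN hgen hx hNx
  · rw [hf, map_eq_zero_iff _ (IsFractionRing.injective (PowerSeries k) E),
      map_algebraMap_toZMod_eq_zero_iff, ← map_natCast Θ p]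
    exact map_dvd_iff Θ
  · have h := pow_ne_one_add_X (Fact.out : p.Prime).ne_zero hc b
    rwa [hf, hΘ, map_add, map_one, PowerSeries.map_X, IsScalarTower.algebraMap_apply k
      (PowerSeries k) E, ← map_mul]

end ModP

/-! ### Open subgroups of `ℤ_p`. -/

section OpenSubgroup

variable {p : ℕ} [Fact p.Prime]

theorem exists_eq_pow_dvd_of_isOpen (A : AddSubgroup ℤ_[p]) (hA : IsOpen (A : Set ℤ_[p])) :
    ∃ n : ℕ, ∀ x, x ∈ A ↔ (p : ℤ_[p]) ^ n ∣ x := by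
  obtain ⟨ε, hε, hball⟩ := Metric.isOpen_iff.mp hA 0 A.zero_mem
  obtain ⟨m, hm⟩ := PadicInt.exists_pow_neg_lt p hε
  have hmA (x : ℤ_[p]) : (p : ℤ_[p]) ^ m * x ∈ A := by
    refine hball ?_
    rw [mem_ball_zero_iff]
    exact ((PadicInt.norm_le_pow_iff_mem_span_pow _ m).mpr
      (Ideal.mem_span_singleton.mpr (dvd_mul_right _ _))).trans_lt hm
  -- `A` is an ideal: modulo `p ^ m`, whose multiples all lie in `A`, a scalar is congruent to a
  -- natural number.
  let I : Ideal ℤ_[p] :=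
    { A with
      smul_mem' := fun c a ha => by
        obtain ⟨d, hd⟩ := Ideal.mem_span_singleton.mp (PadicInt.appr_spec m c)
        have h : c • a = c.appr m • a + (p : ℤ_[p]) ^ m * (d * a) := by
          rw [← mul_assoc, ← hd, nsmul_eq_mul, smul_eq_mul]
          ring
        rw [h]
        exact A.add_mem (A.nsmul_mem ha _) (hmA _) }
  have hp : (p : ℤ_[p]) ≠ 0 := Nat.cast_ne_zero.mpr (Fact.out : p.Prime).ne_zero
  have hI : I ≠ ⊥ := fun h => by
    have h1 : (p : ℤ_[p]) ^ m * 1 ∈ I := hmA 1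
    rw [h, Ideal.mem_bot, mul_one] at h1
    exact pow_ne_zero m hp h1
  obtain ⟨n, hn⟩ := PadicInt.ideal_eq_span_pow_p hI
  refine ⟨n, fun x => ?_⟩
  rw [← Ideal.mem_span_singleton, ← hn]
  rfl

/-- The additive subgroup of `ℤ_p` corresponding to a subgroup of `Multiplicative ℤ_p`. -/
def exponents (S : Subgroup (Multiplicative ℤ_[p])) : AddSubgroup ℤ_[p] where
  carrier := {x | Multiplicative.ofAdd x ∈ S}
  add_mem' := S.mul_mem
  zero_mem' := S.one_mem
  neg_mem' := S.inv_mem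

theorem mem_exponents {S : Subgroup (Multiplicative ℤ_[p])} {x : ℤ_[p]} :
    x ∈ exponents S ↔ Multiplicative.ofAdd x ∈ S := Iff.rfl

end OpenSubgroup

/-! ### Subgroups of `𝒢` containing the central subgroup. -/

section Semidirect

variable {p : ℕ} [Fact p.Prime] {G : Type*} [Group G]

theorem exists_hom_of_isComplement' {H Γ : Subgroup G} [H.Normal] (h : H.IsComplement' Γ)
    {A : Type*} [Group A] (ψ : Γ ≃* A) :
    ∃ π : G →* A, (∀ g, π g = 1 ↔ g ∈ H) ∧ ∀ g : Γ, π g = ψ g := by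
  let q := h.symm.QuotientMulEquiv
  refine ⟨(q.trans ψ).toMonoidHom.comp (QuotientGroup.mk' H), fun g => ?_, fun g => ?_⟩
  · change (q.trans ψ) (g : G ⧸ H) = 1 ↔ _
    rw [map_eq_one_iff _ (q.trans ψ).injective, QuotientGroup.eq_one_iff]
  · change ψ (q (g : G ⧸ H)) = ψ g
    congr 1
    rw [← MulEquiv.eq_symm_apply]
    rfl

/-- If a homomorphism to `ℤ_p` maps the central subgroup `D` onto `p ^ n ℤ_p`, then every subgroup
containing `D` is generated by `D`, one element and a part of the kernel. -/
theorem exists_generator_of_le {H D : Subgroup G} {π : G →* Multiplicative ℤ_[p]}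
    (hπ : ∀ g, π g = 1 ↔ g ∈ H) {n : ℕ}
    (hD : ∀ x, (∃ d ∈ D, π d = Multiplicative.ofAdd x) ↔ (p : ℤ_[p]) ^ n ∣ x) {γ : G}
    (hγ : π γ = Multiplicative.ofAdd ((p : ℤ_[p]) ^ n)) (S : Subgroup G) (hS : D ≤ S) :
    ∃ t ∈ S, (∃ n : ℕ, ∃ h ∈ H, t ^ p ^ n = h * γ) ∧
      ∀ s ∈ S, ∃ h ∈ H, ∃ i : ℕ, ∃ d ∈ D, s = h * t ^ i * d := by
  have hker {a b : G} (hab : π a = π b) : a * b⁻¹ ∈ H := by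
    rw [← hπ, map_mul, map_inv, hab, mul_inv_cancel]
  have hnS (x : ℤ_[p]) (hx : (p : ℤ_[p]) ^ n ∣ x) : x ∈ exponents (S.map π) := by
    obtain ⟨d, hd, hdx⟩ := (hD x).mpr hx
    exact ⟨d, hS hd, hdx⟩
  have hopen : IsOpen (exponents (S.map π) : Set ℤ_[p]) := by
    refine AddSubgroup.isOpen_mono (H₁ := (Ideal.span {(p : ℤ_[p]) ^ n}).toAddSubgroup)
      (fun x hx => hnS x (Ideal.mem_span_singleton.mp hx)) ?_
    have h : ((Ideal.span {(p : ℤ_[p]) ^ n}).toAddSubgroup : Set ℤ_[p]) =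
        Metric.closedBall (0 : ℤ_[p]) ((p : ℝ) ^ (-(n : ℤ))) := by
      ext x
      rw [mem_closedBall_zero_iff, PadicInt.norm_le_pow_iff_mem_span_pow]
      rfl
    rw [h]
    have := (Fact.out : p.Prime).pos
    exact IsUltrametricDist.isOpen_closedBall _ (by positivity)
  obtain ⟨j, hj⟩ := exists_eq_pow_dvd_of_isOpen _ hopen
  -- The image of `S` in `ℤ_p` is `p ^ j ℤ_p`, and `t` lifts its generator. Natural powers of `t`
  -- suffice because `D` covers `p ^ n ℤ_p`.
  obtain ⟨t, ht, htj⟩ := (hj _).mpr dvd_rfl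
  have hjn : j ≤ n := by
    have h := (hj _).mp (hnS _ dvd_rfl)
    refine (pow_dvd_pow_iff (Nat.cast_ne_zero.mpr (Fact.out : p.Prime).ne_zero) ?_).mp h
    exact PadicInt.prime_p.not_isUnit
  have hpow (i : ℕ) : π (t ^ i) = Multiplicative.ofAdd (i * (p : ℤ_[p]) ^ j) := by
    rw [map_pow, htj, ← ofAdd_nsmul, nsmul_eq_mul]
  refine ⟨t, ht, ⟨n - j, _, hker ?_, (inv_mul_cancel_right _ γ).symm⟩, fun s hs => ?_⟩
  · rw [hpow, hγ, Nat.cast_pow, ← pow_add, Nat.sub_add_cancel hjn]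
  · obtain ⟨c, hc⟩ := (hj (π s).toAdd).mp ⟨s, hs, rfl⟩
    obtain ⟨c', hc'⟩ := Ideal.mem_span_singleton.mp (PadicInt.appr_spec (n - j) c)
    generalize c.appr (n - j) = i at hc'
    obtain ⟨d, hd, hdx⟩ := (hD ((p : ℤ_[p]) ^ n * c')).mpr (dvd_mul_right _ _)
    refine ⟨s * (t ^ i * d)⁻¹, hker ?_, i, d, hd, ?_⟩
    · rw [map_mul, hpow, hdx, ← ofAdd_add, ← ofAdd_toAdd (π s), hc, sub_eq_iff_eq_add.mp hc']
      congr 1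
      rw [← Nat.sub_add_cancel hjn, pow_add, Nat.sub_add_cancel hjn]
      ring
    · rw [mul_assoc, inv_mul_cancel_right]

end Semidirect

/-! ### Topology of `Γ` and `Γ₀`. -/

section CentralOpen

variable {p : ℕ} [Fact p.Prime] {G : Type*} [Group G] [TopologicalSpace G]

/-- A central subgroup which is open in a subgroup isomorphic to `ℤ_p` is isomorphic to `ℤ_p`, with
generator `p ^ n` for some `n`. -/
theorem exists_continuousMulEquiv_of_isOpen [T2Space G] {Γ : Subgroup G}
    (ψ : Γ ≃ₜ* Multiplicative ℤ_[p])
    {C : Subgroup (Subgroup.center G)} (hle : C.map (Subgroup.center G).subtype ≤ Γ)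
    (hopen : IsOpen (((C.map (Subgroup.center G).subtype).subgroupOf Γ : Subgroup Γ) : Set Γ)) :
    ∃ (n : ℕ) (e : C ≃ₜ* Multiplicative ℤ_[p]),
      ∀ x : ℤ_[p], (((ofPadic e x : C) : Subgroup.center G) : G) =
        ψ.symm (Multiplicative.ofAdd ((p : ℤ_[p]) ^ n * x)) := by
  let A := exponents (((C.map (Subgroup.center G).subtype).subgroupOf Γ).map
    ψ.toMulEquiv.toMonoidHom)
  have hA (x : ℤ_[p]) : x ∈ A ↔
      (ψ.symm (Multiplicative.ofAdd x) : G) ∈ C.map (Subgroup.center G).subtype := by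
    rw [mem_exponents]
    constructor
    · rintro ⟨g, hg, hgx⟩
      have : ψ.symm (Multiplicative.ofAdd x) = g := by
        rw [← hgx]; exact ψ.symm_apply_apply g
      rw [this]; exact hg
    · intro h
      exact ⟨_, h, ψ.apply_symm_apply _⟩
  have hAopen : IsOpen (A : Set ℤ_[p]) := by
    have h : (A : Set ℤ_[p]) = (fun x => ψ.symm (Multiplicative.ofAdd x)) ⁻¹'
        ((C.map (Subgroup.center G).subtype).subgroupOf Γ : Subgroup Γ) := by
      ext x; exact hA x
    rw [h]
    exact hopen.preimage (ψ.symm.continuous_toFun.comp continuous_ofAdd)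
  obtain ⟨n, hn⟩ := exists_eq_pow_dvd_of_isOpen A hAopen
  let f : Multiplicative ℤ_[p] →* G := Γ.subtype.comp (ψ.symm.toMulEquiv.toMonoidHom.comp
    (AddMonoidHom.toMultiplicative (AddMonoidHom.mulLeft ((p : ℤ_[p]) ^ n))))
  have hf (x : Multiplicative ℤ_[p]) :
      f x = ψ.symm (Multiplicative.ofAdd ((p : ℤ_[p]) ^ n * x.toAdd)) := rfl
  have hfC (x) : f x ∈ C.map (Subgroup.center G).subtype := by
    rw [hf, ← hA, hn]; exact dvd_mul_right _ _
  have hfz (x) : f x ∈ Subgroup.center G := by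
    obtain ⟨c, -, hc⟩ := hfC x
    rw [← hc]; exact c.2
  -- Multiplication by `p ^ n`, read through `ψ`; a continuous bijection from a compact space onto a
  -- Hausdorff one is a homeomorphism.
  let g : Multiplicative ℤ_[p] →* C := (f.codRestrict _ hfz).codRestrict C (fun x => by
    obtain ⟨c, hc, hcx⟩ := hfC x
    have : f.codRestrict _ hfz x = c := Subtype.ext hcx.symm
    rw [this]; exact hc)
  have hg (x) : ((g x : Subgroup.center G) : G) = f x := rfl
  have hgc : Continuous g := by
    refine Continuous.subtype_mk (Continuous.subtype_mk ?_ _) _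
    exact continuous_subtype_val.comp (ψ.symm.continuous_toFun.comp
      (continuous_ofAdd.comp (continuous_const.mul continuous_toAdd)))
  have hbij : Function.Bijective g := by
    constructor
    · intro x y hxy
      have h : f x = f y := by rw [← hg, hxy, hg]
      rw [hf, hf] at h
      have h1 := ψ.symm.injective (Subtype.ext h)
      exact mul_left_cancel₀ (M₀ := ℤ_[p]) (pow_ne_zero n
        (Nat.cast_ne_zero.mpr (Fact.out : p.Prime).ne_zero)) h1
    · intro c
      have hc : ((c : Subgroup.center G) : G) ∈ C.map (Subgroup.center G).subtype :=
        ⟨c, c.2, rfl⟩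
      obtain ⟨x, hx⟩ := (hn (ψ ⟨c, hle hc⟩).toAdd).mp (by
        rw [hA, ofAdd_toAdd, ContinuousMulEquiv.symm_apply_apply]; exact hc)
      refine ⟨Multiplicative.ofAdd x, Subtype.ext (Subtype.ext ?_)⟩
      rw [hg, hf, toAdd_ofAdd, ← hx, ofAdd_toAdd, ContinuousMulEquiv.symm_apply_apply]
  have : CompactSpace (Multiplicative ℤ_[p]) := inferInstanceAs (CompactSpace ℤ_[p])
  let e := Continuous.homeoOfEquivCompactToT2 (f := Equiv.ofBijective g hbij) hgc
  let e' : Multiplicative ℤ_[p] ≃ₜ* C := { e with map_mul' := g.map_mul }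
  exact ⟨n, e'.symm, fun x => rfl⟩

/-- `Γ` is compact, hence closed, and its index `|H|` is finite. -/
theorem isOpen_of_isComplement' [IsTopologicalGroup G] [T2Space G] {H Γ : Subgroup G} [Finite H]
    (h : H.IsComplement' Γ) (ψ : Γ ≃ₜ* Multiplicative ℤ_[p]) : IsOpen (Γ : Set G) := by
  have : CompactSpace (Multiplicative ℤ_[p]) := inferInstanceAs (CompactSpace ℤ_[p])
  have : CompactSpace Γ := ψ.toHomeomorph.symm.compactSpace
  have hclosed : IsClosed (Γ : Set G) := (isCompact_iff_compactSpace.mpr this).isClosed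
  have : Γ.FiniteIndex := ⟨by rw [h.index_eq_card]; exact Nat.card_pos.ne'⟩
  exact Γ.isOpen_of_isClosed_of_finiteIndex hclosed

end CentralOpen

/-! ### Assembling the maximality of `Λ(1 - e)`. -/

section PowerSeriesBase

variable {R : Type*} [CommRing R] {p : ℕ} [Fact p.Prime] (Θ : R ≃+* PowerSeries ℤ_[p])
include Θ

theorem isUnit_natCast_of_not_dvd {m : ℕ} (hm : ¬ p ∣ m) : IsUnit (m : R) := by
  have h : IsUnit (m : ℤ_[p]) := by
    rw [PadicInt.isUnit_iff, PadicInt.norm_natCast_eq_one_iff]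
    exact ((Fact.out : p.Prime).coprime_iff_not_dvd).mpr hm
  have h1 := (h.map (PowerSeries.C (R := ℤ_[p]))).map Θ.symm
  rwa [map_natCast, map_natCast] at h1

theorem exists_natCast_eq_pow_mul_unit {m : ℕ} (hm : m ≠ 0) :
    ∃ (n : ℕ) (u : Rˣ), (m : R) = p ^ n * u := by
  obtain ⟨n, m', hm', rfl⟩ := Nat.exists_eq_pow_mul_and_not_dvd hm p (Fact.out : p.Prime).ne_one
  exact ⟨n, (isUnit_natCast_of_not_dvd Θ hm').unit, by simp⟩

theorem isIntegrallyClosed_of_powerSeries : IsIntegrallyClosed R :=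
  IsIntegrallyClosed.of_equiv Θ.symm

end PowerSeriesBase

section TraceIdempotent

variable {L G : Type*} [Ring L] [Group G] (φ : G →* L) (N : Subgroup G) [Fintype N]

theorem sum_mul_apply_mem {g : G} (hg : g ∈ N) : (∑ n : N, φ n) * φ g = ∑ n : N, φ n := by
  rw [Finset.sum_mul]
  exact Fintype.sum_equiv (Equiv.mulRight ⟨g, hg⟩) _ _ fun n => by simp

theorem commute_sum [N.Normal] (g : G) : Commute (φ g) (∑ n : N, φ n) := by
  rw [Commute, SemiconjBy, Finset.mul_sum, Finset.sum_mul]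
  exact Fintype.sum_equiv (MulAut.conjNormal g).toEquiv _ _ fun n => by
    rw [← map_mul, ← map_mul]
    simp

theorem isIdempotentElem_of_card_mul_eq_sum {e : L} (hu : IsUnit (Nat.card N : L))
    (he : (Nat.card N : L) * e = ∑ n : N, φ n) : e * e = e := by
  refine hu.mul_left_cancel (hu.mul_left_cancel ?_)
  rw [← mul_assoc (Nat.card N : L) e e, he, (Nat.cast_commute _ _).left_comm, he, Finset.mul_sum,
    Finset.sum_congr rfl fun n _ => sum_mul_apply_mem φ N n.2, Finset.sum_const, Finset.card_univ,
    nsmul_eq_mul, Nat.card_eq_fintype_card]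

theorem commute_of_card_mul_eq_sum [N.Normal] {R ι : Type*} [CommRing R] [Algebra R L] [Fintype ι]
    (b : Module.Basis ι R L) (hb : ∀ i, ∃ g, b i = φ g) {e : L} (hu : IsUnit (Nat.card N : L))
    (he : (Nat.card N : L) * e = ∑ n : N, φ n) (a : L) : e * a = a * e := by
  have h (a : L) : Commute a (∑ n : N, φ n) := by
    rw [← b.sum_repr a]
    refine Commute.sum_left _ _ _ fun i _ => ?_
    obtain ⟨g, hg⟩ := hb i
    rw [hg]
    exact (commute_sum φ N g).smul_left _
  refine hu.mul_left_cancel ?_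
  rw [← mul_assoc, he, ← (h a).eq, ← he, ← mul_assoc, ← mul_assoc,
    (Nat.cast_commute (Nat.card N) a).eq]

end TraceIdempotent

theorem isMaximalOrder_one_sub {R L G : Type*} [CommRing R] [Ring L]
    [Algebra R L] [Group G] {p : ℕ} [Fact p.Prime] (hp2 : p ≠ 2) (Θ : R ≃+* PowerSeries ℤ_[p])
    (φ : G →* L) (N : Subgroup G) [N.Normal] [Fintype N] (hpN : ¬ p ∣ Nat.card N)
    {D H : Subgroup G} [Fintype (G ⧸ D)] (b : Module.Basis (G ⧸ D) R L)
    (hb : ∀ w, b w = φ w.out) (T : L → R) (hT : ∀ a w, b.repr a w = T (a * φ w.out⁻¹))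
    (hDc : D ≤ Subgroup.center G) {δ : G → R}
    (hD : ∀ d ∈ D, φ d = algebraMap R L (δ d)) {γ : G} (hγ : γ ∈ D)
    (hΘ : Θ (δ γ) = 1 + PowerSeries.X)
    (hHN : ∀ h ∈ H, h ∉ N → ∀ n ∈ N, ∃ m ∈ N, m * h * m⁻¹ = n * h)
    (hgen : ∀ S : Subgroup G, D ≤ S → ∃ t ∈ S, (∃ n : ℕ, ∃ h ∈ H, t ^ p ^ n = h * γ) ∧
      ∀ s ∈ S, ∃ h ∈ H, ∃ i : ℕ, ∃ d ∈ D, s = h * t ^ i * d)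
    {e : L} (he : (Nat.card N : L) * e = ∑ n : N, φ n) :
    IsMaximalOrder R (toFractions L (1 - e))
      ((LinearMap.mulRight R (toFractions L (1 - e))).comp
        (toFractionsₐ L R).toLinearMap).range := by
  have : IsDomain R := Θ.toMulEquiv.isDomain
  have : IsIntegrallyClosed R := isIntegrallyClosed_of_powerSeries Θ
  have hp0 : (p : R) ≠ 0 := by
    rw [← map_ne_zero_iff Θ Θ.injective, map_natCast, ← map_natCast (PowerSeries.C (R := ℤ_[p])),
      map_ne_zero_iff _ PowerSeries.C_injective]
    exact Nat.cast_ne_zero.mpr (Fact.out : p.Prime).ne_zero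
  have hb' (w) : ∃ g, b w = φ g := ⟨_, hb w⟩
  have hu : IsUnit (Nat.card N : L) := by
    have := (isUnit_natCast_of_not_dvd Θ hpN).map (algebraMap R L)
    rwa [map_natCast] at this
  have he2 := isIdempotentElem_of_card_mul_eq_sum φ N hu he
  have hec := commute_of_card_mul_eq_sum φ N b hb' hu he
  refine isMaximalOrder_range (fun w : G ⧸ D => φ.toHomUnits w.out) T b hb
    (fun a w => by rw [hT, ← map_inv, MonoidHom.coe_toHomUnits]) (p := p) ?_ ?_ hp0
    (exists_natCast_eq_pow_mul_unit Θ Fintype.card_ne_zero) fun a ha hac => ?_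
  · rw [mul_sub, mul_one, sub_mul, one_mul, he2, sub_self, sub_zero]
  · intro a
    rw [sub_mul, mul_sub, hec, one_mul, mul_one]
  · refine dvd_of_forall_dvd_mul_mul_of_powerSeries hp2 Θ φ N hpN b hb' hDc hD hγ hΘ hHN hgen hac ?_
    -- `a(1 - e) = a` means `a e = 0`, so the norm element of `N`, which is `|N| e`, kills `a`.
    rw [mul_sub, mul_one, sub_eq_self] at ha
    rw [← he, mul_assoc, hec, ha, mul_zero]

theorem map_of (p : ℕ) [Fact p.Prime] {A G : Type*} [Group A] [TopologicalSpace A] [Group G]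
    [TopologicalSpace G] (f : A →ₜ* G) (a : A) : map p f (of p a) = of p (f a) :=
  Subtype.ext (funext fun _ => MonoidAlgebra.mapDomain_single)

theorem exists_card_mul_eq_sum (p : ℕ) [Fact p.Prime] {G : Type*} [Group G] [TopologicalSpace G]
    (N : Subgroup G) [Fintype N] (hpN : ¬ p ∣ Nat.card N) :
    ∃ e : IwasawaAlgebra p G, (Nat.card N : IwasawaAlgebra p G) * e = ∑ n : N, ofHom p G n := by
  have h : IsUnit (Nat.card N : ℤ_[p]) := by
    rw [PadicInt.isUnit_iff, PadicInt.norm_natCast_eq_one_iff]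
    exact ((Fact.out : p.Prime).coprime_iff_not_dvd).mpr hpN
  obtain ⟨v, hv⟩ := h.exists_right_inv
  refine ⟨algebraMap ℤ_[p] (IwasawaAlgebra p G) v * ∑ n : N, ofHom p G n, ?_⟩
  rw [← mul_assoc, ← map_natCast (algebraMap ℤ_[p] (IwasawaAlgebra p G)), ← map_mul, hv, map_one,
    one_mul]

theorem traceIdempotent_eq_toFractions (p : ℕ) [Fact p.Prime] {G : Type*} [Group G]
    [TopologicalSpace G] (N : Subgroup G) [Fintype N] {e : IwasawaAlgebra p G}
    (he : (Nat.card N : IwasawaAlgebra p G) * e = ∑ n : N, ofHom p G n) :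
    traceIdempotent p N = toFractions (IwasawaAlgebra p G) e := by
  rw [traceIdempotent, ← fraction_mul_left, finsum_eq_sum_of_fintype]
  congr 1
  exact he.symm

end HybridIwasawa

end

/-! ### The main theorem. -/

open HybridIwasawa

theorem proposition3p12 (p : ℕ) [Fact p.Prime] (hp : Odd p)
    {𝒢 : Type*} [Group 𝒢] [TopologicalSpace 𝒢] [IsTopologicalGroup 𝒢] [CompactSpace 𝒢]
    [T2Space 𝒢] [TotallyDisconnectedSpace 𝒢]
    (H Γ : Subgroup 𝒢) [Finite H] (h𝒢 : HybridIwasawa.IsSemidirect p H Γ)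
    (N : Subgroup H) (hN : HybridIwasawa.IsFrobeniusWithKernel H N) (hpN : ¬ p ∣ Nat.card N) :
    (N.map H.subtype).Normal ∧
      ∀ Γ₀ : Subgroup (Subgroup.center 𝒢),
        Γ₀.map (Subgroup.center 𝒢).subtype ≤ Γ →
        IsOpen (((Γ₀.map (Subgroup.center 𝒢).subtype).subgroupOf Γ : Subgroup Γ) : Set Γ) →
        HybridIwasawa.IsHybrid p (N.map H.subtype) Γ₀ := by
  have hnormal : (N.map H.subtype).Normal := hN.normal_map h𝒢.normal
  refine ⟨hnormal, fun Γ₀ hle hopen => ?_⟩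
  have := h𝒢.normal
  obtain ⟨ψ⟩ := h𝒢.equiv
  have hΓ : IsOpen (Γ : Set 𝒢) := isOpen_of_isComplement' h𝒢.isComplement ψ
  have hD : IsOpen ((Γ₀.map (Subgroup.center 𝒢).subtype : Subgroup 𝒢) : Set 𝒢) := by
    have h := hΓ.isOpenMap_subtype_val _ hopen
    rw [Subgroup.coe_subgroupOf, Subgroup.coe_subtype] at h
    have h1 := Subtype.image_preimage_coe (Γ : Set 𝒢)
      ((Γ₀.map (Subgroup.center 𝒢).subtype : Subgroup 𝒢) : Set 𝒢)
    rw [Set.inter_eq_right.mpr hle] at h1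
    exact h1 ▸ h
  have := Subgroup.quotient_finite_of_isOpen _ hD
  have := Fintype.ofFinite (𝒢 ⧸ Γ₀.map (Subgroup.center 𝒢).subtype)
  have := Fintype.ofFinite (N.map H.subtype)
  obtain ⟨n, ε, hε⟩ := exists_continuousMulEquiv_of_isOpen ψ hle hopen
  obtain ⟨Θ, hΘ⟩ := exists_algEquiv_powerSeries ε
  obtain ⟨π, hπ, hπΓ⟩ := exists_hom_of_isComplement' h𝒢.isComplement ψ.toMulEquiv
  have hcard : Nat.card (N.map H.subtype) = Nat.card N :=
    Nat.card_congr (N.equivMapOfInjective _ H.subtype_injective).symm.toEquiv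
  have hpN' : ¬ p ∣ Nat.card (N.map H.subtype) := by rwa [hcard]
  obtain ⟨e, he⟩ := exists_card_mul_eq_sum p (N.map H.subtype) hpN'
  have htr := traceIdempotent_eq_toFractions p (N.map H.subtype) he
  refine ⟨hnormal, ⟨e, htr.symm⟩, ?_⟩
  rw [htr, ← map_one (toFractions (IwasawaAlgebra p 𝒢)), ← map_sub]
  classical
  -- The scalar by which an element of `Γ₀` acts; the value `0` elsewhere is never used.
  let δ : 𝒢 → IwasawaAlgebra p Γ₀ := fun g =>
    if h : ∃ c : Γ₀, centralInclusion Γ₀ c = g then of p h.choose else 0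
  have hδ (c : Γ₀) : δ (centralInclusion Γ₀ c) = of p c := by
    have h : ∃ c' : Γ₀, centralInclusion Γ₀ c' = centralInclusion Γ₀ c := ⟨c, rfl⟩
    simp only [δ, dif_pos h]
    rw [centralInclusion_injective h.choose_spec]
  refine isMaximalOrder_one_sub (p := p) (H := H) (δ := δ) (γ := centralInclusion Γ₀ (ofPadic ε 1))
    ?_ Θ.toRingEquiv (ofHom p 𝒢) (N.map H.subtype) hpN' (cosetBasis hD) (cosetBasis_apply hD)
    (coeffProj hD) (cosetBasis_repr hD) ?_ ?_ ?_ ?_ ?_ ?_ he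
  · rintro rfl; exact absurd hp (by decide)
  · rintro _ ⟨c, -, rfl⟩; exact c.2
  · rintro _ ⟨c, hc, rfl⟩
    have h := hδ ⟨c, hc⟩
    change ofHom p 𝒢 (centralInclusion Γ₀ ⟨c, hc⟩) =
      algebraMap _ _ (δ (centralInclusion Γ₀ ⟨c, hc⟩))
    rw [hδ, ofHom_apply]
    exact (map_of p (centralInclusion Γ₀) _).symm
  · exact ⟨_, (ofPadic ε 1).2, rfl⟩
  · rw [hδ]; exact hΘ
  · rintro h hh hhN _ ⟨n, hn, rfl⟩
    obtain ⟨m, hm, hmn⟩ := hN.exists_conj_eq_mul (h := ⟨h, hh⟩) (fun h' => hhN ⟨_, h', rfl⟩) hn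
    exact ⟨m, ⟨m, hm, rfl⟩, congrArg Subtype.val hmn⟩
  · refine exists_generator_of_le hπ (n := n) (fun x => ⟨?_, ?_⟩) ?_
    · rintro ⟨_, ⟨c, hc, rfl⟩, hcx⟩
      obtain ⟨y, hy⟩ := ofPadic_surjective ε ⟨c, hc⟩
      have h := hε y
      rw [hy] at h
      change π (c : 𝒢) = _ at hcx
      rw [h, hπΓ] at hcx
      have h1 := (ψ.apply_symm_apply _).symm.trans hcx
      exact ⟨y, (Multiplicative.ofAdd.injective h1).symm⟩
    · rintro ⟨y, rfl⟩
      refine ⟨_, ⟨_, (ofPadic ε y).2, rfl⟩, ?_⟩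
      change π (((ofPadic ε y : Γ₀) : Subgroup.center 𝒢) : 𝒢) = _
      rw [hε, hπΓ]
      exact ψ.apply_symm_apply _
    · change π (((ofPadic ε 1 : Γ₀) : Subgroup.center 𝒢) : 𝒢) = _
      rw [hε, hπΓ, mul_one]
      exact ψ.apply_symm_apply _
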